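/- A monotone triangle of size $n$ is a triangular array of integers $(a_{i,j})_{1\le j\le i\le n}$ with $a_{i,j}<a_{i,j+1}$ along rows and $a_{i+1,j}\le a_{i,j}\le a_{i+1,j+1}$ along North-East- and South-East-diagonals; its bottom row is $(a_{n,1},\dots,a_{n,n})$ and its left-most NE-diagonal consists of the entries $a_{1,1},a_{2,1},\dots,a_{n,1}$. For $n\ge 1$ let $$\alpha(n;k_1,\dots,k_n)=\prod_{1\le p<q\le n}\bigl(\mathrm{id}-E_{k_p}+E_{k_p}E_{k_q}\bigr)\prod_{1\le i<j\le n}\frac{k_j-k_i}{j-i}\in\mathbb{Q}[k_1,\dots,k_n],$$ where $E_x f(x)=f(x+1)$, and let $\Delta_x f(x)=f(x+1)-f(x)$. For integers $n,d\ge 1$ and $i\ge 0$ put $$C^{(d)}_{n,i}=(-1)^i\,\Delta^i_{k_1}\,\alpha(n;k_1,2d,3d,\dots,nd)\big|_{k_1=d+1}.$$ Fix integers $n,d\ge 1$. Then: 1. For all integers $k_1<k_2<\dots<k_n$, the value $\alpha(n;k_1,\dots,k_n)$ is the number of monotone triangles with bottom row $(k_1,\dots,k_n)$. 2. For all $i\ge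 0$, $C^{(d)}_{n,i}$ is the number of monotone triangles with bottom row $(d,2d,\dots,nd)$ and exactly $i+1$ entries equal to $d$ in the left-most NE-diagonal. 3. (Proposition 3.1) For all $0\le i\le n-1$, $$C^{(d)}_{n,i}=\sum_{j=i}^{n-1}\binom{n(d+1)-i-2}{j-i}(-1)^{j+n+1}\,C^{(d)}_{n,j}.$$ -/

import Mathlib

/-- A monotone triangle of size `n`: a triangular array of integers with row `i` (for `i < n`) of
length `i + 1`, strictly increasing along rows and weakly increasing along North-East- and
South-East-diagonals. Indices are zero-based. -/
def IsMonotoneTriangle {n : ℕ} (a : (i : Fin n) → Fin ((i : ℕ) + 1) → ℤ) : Prop :=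
  (∀ i, StrictMono (a i)) ∧
  ∀ (i i' : Fin n) (_ : (i' : ℕ) = i + 1) (j : Fin ((i : ℕ) + 1)),
    a i' ⟨j, by omega⟩ ≤ a i j ∧ a i j ≤ a i' ⟨(j : ℕ) + 1, by omega⟩

/-- The monotone triangles of size `n` with bottom row `k`. -/
def monotoneTriangles {n : ℕ} (k : Fin n → ℤ) :
    Set ((i : Fin n) → Fin ((i : ℕ) + 1) → ℤ) :=
  {a | IsMonotoneTriangle a ∧
    ∀ (i : Fin n) (j : Fin ((i : ℕ) + 1)), (i : ℕ) + 1 = n → a i j = k ⟨j, by omega⟩}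

/-- The number of entries equal to `c` in the left-most North-East-diagonal, which consists of the
first entries of all the rows. -/
def leftDiagonalCount {n : ℕ} (c : ℤ) (a : (i : Fin n) → Fin ((i : ℕ) + 1) → ℤ) : ℕ :=
  (Finset.univ.filter fun i : Fin n => a i 0 = c).card

/-- The operator `P(E_{k_1}, …, E_{k_n})` applied to the polynomial `f`, where `E_{k_i}` is the
shift `k_i ↦ k_i + 1`: the monomial `∏ E_{k_i} ^ m_i` shifts `k` to `k + m`. -/
noncomputable def applyShifts {n : ℕ} (P f : MvPolynomial (Fin n) ℚ) : MvPolynomial (Fin n) ℚ :=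
  ∑ m ∈ P.support,
    P.coeff m • MvPolynomial.aeval
      (fun i => MvPolynomial.X i + MvPolynomial.C (m i : ℚ) : Fin n → MvPolynomial (Fin n) ℚ) f

/-- The polynomial `α(n; k_1, …, k_n)` given by the operator formula
`∏_{p < q} (id - E_{k_p} + E_{k_p} E_{k_q}) ∏_{i < j} (k_j - k_i) / (j - i)`; the last product is
the determinant of the matrix with entries `binom(k_i, j - 1)`, `1 ≤ i, j ≤ n`. -/
noncomputable def alpha (n : ℕ) : MvPolynomial (Fin n) ℚ :=
  applyShifts
    (∏ p : Fin n, ∏ q ∈ Finset.Ioi p,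
      (1 - MvPolynomial.X p + MvPolynomial.X p * MvPolynomial.X q))
    (∏ i : Fin n, ∏ j ∈ Finset.Ioi i,
      MvPolynomial.C (1 / ((j : ℚ) - (i : ℚ))) * (MvPolynomial.X j - MvPolynomial.X i))

/-- The value `α(n; k_1, …, k_n)` at integers `k_1, …, k_n`. -/
noncomputable def alphaValue {n : ℕ} (k : Fin n → ℤ) : ℚ :=
  MvPolynomial.eval (fun j => (k j : ℚ)) (alpha n)

/-- The number `C^{(d)}_{n,i} = (-1)^i Δ_{k_1}^i α(n; k_1, 2d, 3d, …, nd)` at `k_1 = d + 1`. -/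
noncomputable def refinedNumber (n : ℕ) (d : ℤ) (i : ℕ) : ℚ :=
  (-1) ^ i *
    (fwdDiff (1 : ℤ))^[i]
      (fun k₁ : ℤ =>
        alphaValue fun j : Fin n => if (j : ℕ) = 0 then k₁ else ((j : ℕ) + 1 : ℤ) * d)
      (d + 1)

/-! Polynomials in the shifts act on functions on ℤ^n, so that α = P·V, where P is the product of
the factors id - E_p + E_p E_q over p < q and V is the normalised Vandermonde product, rewritten as
det binom(k_i, j), j = 0, …, n - 1.

Counting. Let B = P·det binom(k_i, j + 1). Pascal's rule gives ∏ Δ_{k_i} B = α. Expanding V along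
its constant column turns α(n + 1; k) into an alternating sum of values of B (`alphaValue_succ`).
The same sum arises when ∏ Δ B is summed over the rows above k (`sum_rowsAbove_prod_diff`): the sum
telescopes, and the corrections for strictness cancel because P times the factor of a reversed
adjacent pair is symmetric in that pair, while the determinant is antisymmetric. Hence α satisfies
the recursion of monotone triangles.

Refinement. The same computation with the first entry held fixed shows that -Δ_{k_1} deletes the
bottom entry of the left-most diagonal (`alphaValue_cons_sub`). So (-1)^i Δ^i at x counts triangles
with at least i + 1 entries x on that diagonal, and evaluation at d + 1 instead of d makes the count
exact.

Linear system. Elementary symmetric polynomials of positive degree in the Δ_{k_i} kill V, which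
yields a cyclic rotation rule for α (`alphaValue_snoc`). Together with reflection and translation it
gives a symmetry of α(n; x, 2d, …, nd) in x. Taking differences of this symmetry and expanding by
Newton's formula at d + 1 produces the equations; the expansion stops because the counts C vanish
for i ≥ n. -/

open MvPolynomial

/-! ### Shift operators acting on functions on ℤ^ι -/

/-- The action of polynomials in the shift operators on functions on `ℤ^ι`: the variable `X i` acts
as the shift `k_i ↦ k_i + 1`. -/
noncomputable def shiftAction (ι : Type*) :
    MvPolynomial ι ℚ →ₐ[ℚ] Module.End ℚ ((ι → ℤ) → ℚ) :=
  AddMonoidAlgebra.lift ℚ (Module.End ℚ ((ι → ℤ) → ℚ)) (ι →₀ ℕ)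
    { toFun := fun m =>
        { toFun := fun f k => f (k + fun i => ((Multiplicative.toAdd m) i : ℤ))
          map_add' := fun _ _ => rfl
          map_smul' := fun _ _ => rfl }
      map_one' := by
        ext f k
        simp only [toAdd_one, Finsupp.coe_zero, Pi.zero_apply, Nat.cast_zero, LinearMap.coe_mk,
          AddHom.coe_mk, Module.End.one_apply]
        congr 1
        ext i
        simp
      map_mul' := fun m m' => by
        ext f k
        simp only [LinearMap.coe_mk, AddHom.coe_mk, Module.End.mul_apply]
        congr 1
        ext i
        simp [add_assoc] }

theorem shiftAction_monomial {ι : Type*} (m : ι →₀ ℕ) (c : ℚ) (f : (ι → ℤ) → ℚ) (k : ι → ℤ) :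
    shiftAction ι (monomial m c) f k = c * f (k + fun i => (m i : ℤ)) := by
  change (AddMonoidAlgebra.lift ℚ (Module.End ℚ ((ι → ℤ) → ℚ)) (ι →₀ ℕ) _
    (AddMonoidAlgebra.single m c)) f k = _
  rw [AddMonoidAlgebra.lift_single]
  simp

theorem shiftAction_C {ι : Type*} (c : ℚ) (f : (ι → ℤ) → ℚ) :
    shiftAction ι (C c) f = c • f := by
  change shiftAction ι (algebraMap ℚ _ c) f = _
  rw [AlgHom.commutes]
  rfl

theorem shiftAction_X {ι : Type*} [DecidableEq ι] (i : ι) (f : (ι → ℤ) → ℚ) (k : ι → ℤ) :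
    shiftAction ι (X i) f k = f (k + Pi.single i 1) := by
  rw [X, shiftAction_monomial, one_mul]
  congr 2
  ext j
  by_cases h : j = i
  · subst h; simp
  · simp [h]

theorem shiftAction_mul {ι : Type*} (P Q : MvPolynomial ι ℚ) (f : (ι → ℤ) → ℚ) :
    shiftAction ι (P * Q) f = shiftAction ι P (shiftAction ι Q f) := by
  rw [map_mul, Module.End.mul_apply]

theorem shiftAction_one {ι : Type*} (f : (ι → ℤ) → ℚ) : shiftAction ι 1 f = f := by
  rw [map_one, Module.End.one_apply]

/-- A change of variables `π` intertwines the shift actions along `φ` if it does so for the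
variables. -/
theorem shiftAction_comp {ι κ : Type*} [DecidableEq ι]
    (φ : MvPolynomial ι ℚ →ₐ[ℚ] MvPolynomial κ ℚ) (π : (ι → ℤ) → κ → ℤ)
    (h : ∀ (i : ι) (g : (κ → ℤ) → ℚ) (k : ι → ℤ),
      g (π (k + Pi.single i 1)) = shiftAction κ (φ (X i)) g (π k))
    (P : MvPolynomial ι ℚ) (g : (κ → ℤ) → ℚ) (k : ι → ℤ) :
    shiftAction ι P (fun k => g (π k)) k = shiftAction κ (φ P) g (π k) := by
  induction P using MvPolynomial.induction_on generalizing g k with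
  | C a =>
    rw [shiftAction_C, ← algebraMap_eq, AlgHom.commutes, algebraMap_eq, shiftAction_C]
    rfl
  | add P Q hP hQ =>
    simp only [map_add, LinearMap.add_apply, Pi.add_apply, hP, hQ]
  | mul_X P i hP =>
    rw [shiftAction_mul, map_mul, shiftAction_mul, ← hP]
    refine congrFun (congrArg _ (funext fun k => ?_)) k
    rw [shiftAction_X, h i g]

theorem shiftAction_rename {ι κ : Type*} [DecidableEq ι] [DecidableEq κ] (s : ι → κ)
    (π : (ι → ℤ) → κ → ℤ)
    (h : ∀ (i : ι) (k : ι → ℤ), π (k + Pi.single i 1) = π k + Pi.single (s i) 1)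
    (P : MvPolynomial ι ℚ) (g : (κ → ℤ) → ℚ) (k : ι → ℤ) :
    shiftAction κ (rename s P) g (π k) = shiftAction ι P (fun k => g (π k)) k := by
  rw [← shiftAction_comp (rename s) π]
  intro i g k
  rw [rename_X, shiftAction_X, h]

/-- Permuting the coordinates. -/
theorem shiftAction_perm {ι : Type*} [DecidableEq ι] (σ : Equiv.Perm ι)
    (P : MvPolynomial ι ℚ) (g : (ι → ℤ) → ℚ) (k : ι → ℤ) :
    shiftAction ι P g (k ∘ σ) =
      shiftAction ι (rename σ P) (fun k => g (k ∘ σ)) k := by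
  have := shiftAction_rename σ (fun k : ι → ℤ => k ∘ σ.symm) (fun i k => by
    ext j
    simp only [Function.comp_apply, Pi.add_apply, Pi.single_apply, Equiv.symm_apply_eq]) P
    (fun k => g (k ∘ σ)) (k ∘ σ)
  simpa [Function.comp_assoc] using this.symm

theorem shiftAction_prod_X_pow {ι : Type*} [Fintype ι] (m : ι → ℕ) (f : (ι → ℤ) → ℚ) (k : ι → ℤ) :
    shiftAction ι (∏ i, X i ^ m i) f k = f (k + fun i => (m i : ℤ)) := by
  have : (∏ i, X i ^ m i : MvPolynomial ι ℚ) = monomial (Finsupp.equivFunOnFinite.symm m) 1 := by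
    rw [monomial_eq, Finsupp.prod_fintype _ _ (by simp)]
    simp
  rw [this, shiftAction_monomial]
  simp

theorem shiftAction_X_pow {ι : Type*} [DecidableEq ι] (i : ι) (m : ℕ) (f : (ι → ℤ) → ℚ)
    (k : ι → ℤ) : shiftAction ι (X i ^ m) f k = f (k + Pi.single i (m : ℤ)) := by
  induction m generalizing k with
  | zero => simp
  | succ m ih =>
    rw [pow_succ', shiftAction_mul, shiftAction_X, ih, add_assoc, ← Pi.single_add]
    push_cast
    rw [add_comm (1 : ℤ)]

/-- The action of a product of linear polynomials on a product of functions of one variable. -/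
theorem shiftAction_prod_linear_prod {ι : Type*} [Fintype ι] [DecidableEq ι] (a b : ℚ)
    (f : ι → ℤ → ℚ) :
    shiftAction ι (∏ q, (C a + C b * X q)) (fun k => ∏ q, f q (k q)) =
      fun k => ∏ q, (a * f q (k q) + b * f q (k q + 1)) := by
  suffices h : ∀ s : Finset ι,
      shiftAction ι (∏ q ∈ s, (C a + C b * X q)) (fun k => ∏ q, f q (k q)) =
      fun k => ∏ q, if q ∈ s then a * f q (k q) + b * f q (k q + 1) else f q (k q) by
    simpa using h Finset.univ
  intro s
  induction s using Finset.induction_on with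
  | empty => simp
  | insert i s hi ih =>
    rw [Finset.prod_insert hi, shiftAction_mul, ih]
    ext k
    simp only [map_add, LinearMap.add_apply, shiftAction_mul, shiftAction_C, Pi.add_apply,
      Pi.smul_apply, smul_eq_mul, shiftAction_X]
    simp only [← Finset.mul_prod_erase Finset.univ _ (Finset.mem_univ i), hi, if_false,
      Finset.mem_insert_self, if_true, Pi.single_eq_same]
    have h1 : ∀ x ∈ Finset.univ.erase i, x ≠ i := fun x hx => Finset.ne_of_mem_erase hx
    rw [Finset.prod_congr rfl fun x hx =>
        show _ = if x ∈ insert i s then a * f x (k x) + b * f x (k x + 1) else f x (k x) by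
          simp [h1 x hx],
      Finset.prod_congr (f := fun x => if x ∈ s then
          a * f x (k x + (Pi.single i 1 : ι → ℤ) x) + b * f x (k x + (Pi.single i 1 : ι → ℤ) x + 1)
          else f x (k x + (Pi.single i 1 : ι → ℤ) x)) rfl fun x hx =>
        show _ = if x ∈ insert i s then a * f x (k x) + b * f x (k x + 1) else f x (k x) by
          simp [h1 x hx]]
    ring

theorem shiftAction_prod_linear_det {ι : Type*} [Fintype ι] [DecidableEq ι] (a b : ℚ)
    (c : ι → ℤ → ℚ) :
    shiftAction ι (∏ q, (C a + C b * X q)) (fun k => (Matrix.of fun i j => c j (k i)).det) =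
      fun k => (Matrix.of fun i j => a * c j (k i) + b * c j (k i + 1)).det := by
  have h : ∀ u : ι → ℤ → ℚ, (fun k : ι → ℤ => (Matrix.of fun i j => u j (k i)).det) =
      ∑ σ : Equiv.Perm ι, ((Equiv.Perm.sign σ : ℤ) : ℚ) • fun k : ι → ℤ => ∏ i, u (σ i) (k i) := by
    intro u
    ext k
    rw [← Matrix.det_transpose, Matrix.det_apply']
    simp
  rw [h, map_sum]
  ext k
  rw [← Matrix.det_transpose, Matrix.det_apply', Finset.sum_apply]
  refine Finset.sum_congr rfl fun σ _ => ?_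
  rw [map_smul, shiftAction_prod_linear_prod a b fun i => c (σ i)]
  simp

/-! ### Binomial determinants and the Vandermonde product -/

/-- The determinant of the matrix with entries `binom(k_i, j + s)`. -/
noncomputable def binomialDet (s n : ℕ) (k : Fin n → ℤ) : ℚ :=
  (Matrix.of fun i j : Fin n => ((Ring.choose (k i) ((j : ℕ) + s) : ℤ) : ℚ)).det

theorem factorial_mul_ringChoose (x : ℤ) (j : ℕ) :
    (j.factorial : ℚ) * ((Ring.choose x j : ℤ) : ℚ) = (descPochhammer ℚ j).eval (x : ℚ) := by
  have h := Ring.descPochhammer_eq_factorial_smul_choose x j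
  rw [← Polynomial.aeval_eq_smeval, nsmul_eq_mul, Polynomial.coe_aeval_eq_eval] at h
  rw [← Int.cast_natCast, ← Int.cast_mul, ← h, ← descPochhammer_map (Int.castRingHom ℚ)]
  exact (Polynomial.eval_intCast_map (Int.castRingHom ℚ) _ x).symm

theorem det_vandermonde_eq_binomialDet {n : ℕ} (k : Fin n → ℤ) :
    ∏ i : Fin n, ∏ j ∈ Finset.Ioi i, ((k j : ℚ) - k i) =
      (∏ j : Fin n, ((j : ℕ).factorial : ℚ)) * binomialDet 0 n k := by
  rw [← Matrix.det_vandermonde (fun i => (k i : ℚ)),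
    Matrix.det_eval_matrixOfPolynomials_eq_det_vandermonde _
      (fun j : Fin n => descPochhammer ℚ (j : ℕ)) (fun j => descPochhammer_natDegree ℚ j)
      (fun j => monic_descPochhammer ℚ j),
    binomialDet, ← Matrix.det_mul_row]
  congr 1
  ext i j
  simp [factorial_mul_ringChoose]

theorem binomialDet_id (n : ℕ) : binomialDet 0 n (fun i => ((i : ℕ) : ℤ)) = 1 := by
  rw [binomialDet, Matrix.det_of_isLowerTriangular]
  · simp [Ring.choose_natCast]
  · intro i j hij
    have hij : i < j := hij
    simp [Ring.choose_natCast, Nat.choose_eq_zero_of_lt hij]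

theorem binomialDet_zero_eq_prod {n : ℕ} (k : Fin n → ℤ) :
    binomialDet 0 n k =
      ∏ i : Fin n, ∏ j ∈ Finset.Ioi i, (1 / ((j : ℚ) - (i : ℚ)) * ((k j : ℚ) - k i)) := by
  -- The point k_i = i, where the binomial matrix is unitriangular, identifies ∏ (j - i) with ∏ j!.
  have h := det_vandermonde_eq_binomialDet (fun i : Fin n => ((i : ℕ) : ℤ))
  rw [binomialDet_id, mul_one] at h
  simp only [Finset.prod_mul_distrib, det_vandermonde_eq_binomialDet, one_div,
    Finset.prod_inv_distrib]
  push_cast at h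
  rw [h, inv_mul_cancel_left₀]
  exact Finset.prod_ne_zero_iff.2 fun i _ => by positivity

theorem binomialDet_zero_add_const {n : ℕ} (k : Fin n → ℤ) (c : ℤ) :
    binomialDet 0 n (fun i => k i + c) = binomialDet 0 n k := by
  simp [binomialDet_zero_eq_prod]

theorem binomialDet_comp_perm (s : ℕ) {n : ℕ} (σ : Equiv.Perm (Fin n)) (k : Fin n → ℤ) :
    binomialDet s n (k ∘ σ) = (Equiv.Perm.sign σ : ℤ) * binomialDet s n k := by
  rw [binomialDet, binomialDet, ← Matrix.det_permute]
  rfl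

theorem binomialDet_zero_neg_rev {n : ℕ} (k : Fin n → ℤ) :
    binomialDet 0 n (fun i => -k i.rev) = binomialDet 0 n k := by
  simp only [binomialDet_zero_eq_prod]
  rw [Finset.prod_sigma', Finset.prod_sigma']
  refine Finset.prod_nbij' (fun x => ⟨x.2.rev, x.1.rev⟩) (fun x => ⟨x.2.rev, x.1.rev⟩)
    ?_ ?_ ?_ ?_ ?_
  · simp
  · simp
  · simp
  · simp
  · rintro ⟨i, j⟩ h
    simp only [Finset.mem_sigma, Finset.mem_univ, Finset.mem_Ioi, true_and] at h
    have h1 : ((i.rev : ℕ) : ℚ) = n - (i + 1) := by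
      rw [Fin.val_rev, Nat.cast_sub (by omega)]; simp
    have h2 : ((j.rev : ℕ) : ℚ) = n - (j + 1) := by
      rw [Fin.val_rev, Nat.cast_sub (by omega)]; simp
    simp only [h1, h2]
    push_cast
    ring_nf

/-- The product of the differences `Δ_{k_i}` lowers the binomial coefficients. -/
theorem shiftAction_prod_diff_binomialDet (s n : ℕ) :
    shiftAction (Fin n) (∏ i, (X i - 1)) (binomialDet (s + 1) n) = binomialDet s n := by
  have h := shiftAction_prod_linear_det (ι := Fin n) (-1) 1
    (fun j x => ((Ring.choose x ((j : ℕ) + (s + 1)) : ℤ) : ℚ))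
  have h1 : (∏ q : Fin n, (C (-1) + C 1 * X q) : MvPolynomial (Fin n) ℚ) = ∏ i, (X i - 1) := by
    refine Finset.prod_congr rfl fun i _ => ?_
    simp only [map_neg, map_one]
    ring
  rw [h1] at h
  refine h.trans ?_
  ext k
  rw [binomialDet]
  congr 1
  ext i j
  simp only [Matrix.of_apply]
  rw [← add_assoc, Ring.choose_succ_succ]
  push_cast
  ring

/-- The operators `∏_q (1 + z Δ_{k_q})` fix the Vandermonde determinant. -/
theorem shiftAction_prod_one_add_smul_diff_binomialDet (n : ℕ) (z : ℚ) :
    shiftAction (Fin n) (∏ i, (1 + C z * (X i - 1))) (binomialDet 0 n) = binomialDet 0 n := by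
  have h := shiftAction_prod_linear_det (ι := Fin n) (1 - z) z
    (fun j x => ((Ring.choose x ((j : ℕ) + 0) : ℤ) : ℚ))
  have h1 : (∏ q : Fin n, (C (1 - z) + C z * X q) : MvPolynomial (Fin n) ℚ) =
      ∏ i, (1 + C z * (X i - 1)) := by
    refine Finset.prod_congr rfl fun i _ => ?_
    simp only [map_sub, map_one]
    ring
  rw [h1] at h
  refine h.trans ?_
  ext k
  rw [binomialDet]
  cases n with
  | zero => simp
  | succ n =>
    symm
    -- By Pascal's rule the operator adds z times the preceding original column to each column; the
    -- coefficient -z undoes this.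
    refine Matrix.det_eq_of_forall_col_eq_smul_add_pred (fun _ => -z) (fun i => ?_) fun i j => ?_
    · simp
    · simp only [Matrix.of_apply, Fin.val_succ, Fin.val_castSucc, add_zero,
        Ring.choose_succ_succ]
      push_cast
      ring

/-! ### The operator product and its symmetry under adjacent swaps -/

/-- The factor `id - E_p + E_p E_q`. -/
noncomputable def pairOp {ι : Type*} (p q : ι) : MvPolynomial ι ℚ := 1 - X p + X p * X q

/-- The product of the factors `id - E_p + E_p E_q` over all `p < q`. -/
noncomputable def pairOpProd (n : ℕ) : MvPolynomial (Fin n) ℚ :=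
  ∏ p : Fin n, ∏ q : Fin n, if p < q then pairOp p q else 1

theorem alphaValue_eq_shiftAction {n : ℕ} (k : Fin n → ℤ) :
    alphaValue k = shiftAction (Fin n) (pairOpProd n) (binomialDet 0 n) k := by
  have h : (∏ p : Fin n, ∏ q ∈ Finset.Ioi p, (1 - X p + X p * X q) : MvPolynomial (Fin n) ℚ) =
      pairOpProd n := by
    refine Finset.prod_congr rfl fun p _ => ?_
    rw [← Finset.prod_filter]
    refine Finset.prod_congr ?_ fun _ _ => rfl
    ext q
    simp
  rw [alphaValue, alpha, h, applyShifts, map_sum]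
  conv_rhs => rw [(pairOpProd n).as_sum, map_sum, LinearMap.sum_apply, Finset.sum_apply]
  refine Finset.sum_congr rfl fun m _ => ?_
  rw [smul_eval, shiftAction_monomial, binomialDet_zero_eq_prod]
  simp

theorem rename_pairOp {ι κ : Type*} (s : ι → κ) (p q : ι) :
    rename s (pairOp p q) = pairOp (s p) (s q) := by
  simp [pairOp]

/-- Swapping neighbours reverses only the pair (i, j); all other pairs p < q are permuted among
themselves with their order kept. -/
theorem rename_swap_pairOpProd_mul {n : ℕ} (i j : Fin n) (h : (i : ℕ) + 1 = j) :
    rename (Equiv.swap i j) (pairOpProd n) * pairOp i j = pairOpProd n * pairOp j i := by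
  set S := (Finset.univ : Finset (Fin n × Fin n)).filter fun x => x.1 < x.2 with hS
  have hij : (i, j) ∈ S := by
    simp only [hS, Finset.mem_filter, Finset.mem_univ, true_and]
    exact Fin.lt_def.2 (by omega)
  have h1 : pairOpProd n = pairOp i j * ∏ x ∈ S.erase (i, j), pairOp x.1 x.2 := by
    rw [Finset.mul_prod_erase S (fun x => pairOp x.1 x.2) hij, Finset.prod_filter,
      Fintype.prod_prod_type]
    rfl
  have hmem : ∀ x ∈ S.erase (i, j), (Equiv.swap i j x.1, Equiv.swap i j x.2) ∈ S.erase (i, j) := by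
    rintro ⟨p, q⟩ hx
    simp only [hS, Finset.mem_erase, ne_eq, Prod.mk.injEq, Finset.mem_filter, Finset.mem_univ,
      true_and, Fin.lt_def, Equiv.swap_apply_def, Fin.ext_iff] at hx ⊢
    split_ifs <;> omega
  have h2 : rename (Equiv.swap i j) (∏ x ∈ S.erase (i, j), pairOp x.1 x.2) =
      ∏ x ∈ S.erase (i, j), pairOp x.1 x.2 := by
    rw [map_prod]
    refine Finset.prod_nbij' (fun x => (Equiv.swap i j x.1, Equiv.swap i j x.2))
      (fun x => (Equiv.swap i j x.1, Equiv.swap i j x.2)) hmem hmem ?_ ?_ ?_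
    · simp
    · simp
    · intro x _
      rw [rename_pairOp]
  rw [h1, map_mul, h2, rename_pairOp, Equiv.swap_apply_left, Equiv.swap_apply_right]
  ring

/-- The property of a function `B` that lets consecutive summations telescope. -/
def AdjacentVanishing {n : ℕ} (B : (Fin n → ℤ) → ℚ) : Prop :=
  ∀ i j : Fin n, (i : ℕ) + 1 = j → ∀ k : Fin n → ℤ, k i = k j →
    B k - B (k + Pi.single j 1) + B (k + Pi.single i 1 + Pi.single j 1) = 0

/-- Multiplying the operator product by the factor of the reversed pair (j, i) makes it symmetric in
i and j. Applied to an antisymmetric determinant it gives an antisymmetric function, which vanishes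
where k_i = k_j. -/
theorem adjacentVanishing_shiftAction (s n : ℕ) :
    AdjacentVanishing (shiftAction (Fin n) (pairOpProd n) (binomialDet s n)) := by
  intro i j h k hk
  have hne : i ≠ j := fun e => by subst e; omega
  set Q := pairOpProd n * pairOp j i with hQ
  have hsym : rename (Equiv.swap i j) Q = Q := by
    rw [hQ, map_mul, rename_pairOp, Equiv.swap_apply_left, Equiv.swap_apply_right,
      rename_swap_pairOpProd_mul i j h]
  have hk' : k ∘ Equiv.swap i j = k := by
    ext x
    simp only [Function.comp_apply, Equiv.swap_apply_def]
    split_ifs with h1 h2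
    · rw [h1, hk]
    · rw [h2, hk]
    · rfl
  have h0 : shiftAction (Fin n) Q (binomialDet s n) k = 0 := by
    have h1 := shiftAction_perm (Equiv.swap i j) Q (binomialDet s n) k
    have h2 : (fun k : Fin n → ℤ => binomialDet s n (k ∘ Equiv.swap i j)) =
        (-1 : ℚ) • binomialDet s n := by
      ext k
      rw [binomialDet_comp_perm, Equiv.Perm.sign_swap hne]
      simp
    rw [hsym, hk', h2, map_smul, Pi.smul_apply, smul_eq_mul] at h1
    linarith
  rw [hQ, mul_comm, shiftAction_mul, pairOp, map_add, map_sub, LinearMap.add_apply,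
    LinearMap.sub_apply, shiftAction_one, shiftAction_mul] at h0
  simpa only [Pi.add_apply, Pi.sub_apply, shiftAction_X, add_right_comm] using h0

/-! ### Laplace expansion of α -/

/-- Omitting the `r`-th entry and raising all the later ones by one. -/
def omitShift {n : ℕ} (r : Fin (n + 1)) (k : Fin (n + 1) → ℤ) (q : Fin n) : ℤ :=
  k (r.succAbove q) + if r < r.succAbove q then 1 else 0

theorem binomialDet_zero_succ (n : ℕ) (k : Fin (n + 1) → ℤ) :
    binomialDet 0 (n + 1) k =
      ∑ r : Fin (n + 1), (-1) ^ (r : ℕ) * binomialDet 1 n (fun q => k (r.succAbove q)) := by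
  rw [binomialDet, Matrix.det_succ_column_zero]
  refine Finset.sum_congr rfl fun r _ => ?_
  have : (Matrix.of fun i j : Fin (n + 1) =>
      ((Ring.choose (k i) ((j : ℕ) + 0) : ℤ) : ℚ)).submatrix r.succAbove Fin.succ =
      Matrix.of fun i j : Fin n => ((Ring.choose (k (r.succAbove i)) ((j : ℕ) + 1) : ℤ) : ℚ) := by
    ext i j
    simp
  rw [this, binomialDet]
  simp

/-- The function ignores k_r, so E_r acts as 1. A factor id - E_p + E_p E_r then becomes id, and id
- E_r + E_r E_q becomes E_q: this is the shift of the entries after r. -/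
theorem shiftAction_pairOpProd_succAbove {n : ℕ} (r : Fin (n + 1)) (g : (Fin n → ℤ) → ℚ)
    (k : Fin (n + 1) → ℤ) :
    shiftAction (Fin (n + 1)) (pairOpProd (n + 1)) (fun k => g fun q => k (r.succAbove q)) k =
      shiftAction (Fin n) (pairOpProd n) g (omitShift r k) := by
  rw [shiftAction_comp (aeval (r.insertNth (α := fun _ => MvPolynomial (Fin n) ℚ) 1 X))
    (fun (k : Fin (n + 1) → ℤ) q => k (r.succAbove q))]
  · have h : aeval (r.insertNth (α := fun _ => MvPolynomial (Fin n) ℚ) 1 X)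
        (pairOpProd (n + 1)) =
        (∏ q : Fin n, X q ^ (if r < r.succAbove q then 1 else 0)) * pairOpProd n := by
      have hs : ∀ q : Fin n, aeval (r.insertNth (α := fun _ => MvPolynomial (Fin n) ℚ) 1 X)
          (X (r.succAbove q) : MvPolynomial (Fin (n + 1)) ℚ) = X q := fun q => by simp
      have hr : aeval (r.insertNth (α := fun _ => MvPolynomial (Fin n) ℚ) 1 X)
          (X r : MvPolynomial (Fin (n + 1)) ℚ) = 1 := by simp
      rw [pairOpProd, Fin.prod_univ_succAbove _ r]
      simp only [Fin.prod_univ_succAbove _ r, lt_irrefl, if_false, one_mul, map_mul, map_prod,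
        Finset.prod_mul_distrib, pairOpProd, apply_ite (aeval _), map_one, pairOp, map_add,
        map_sub, hs, hr, Fin.succAbove_lt_succAbove_iff]
      have h1 : ∀ q : Fin n, (1 - X q + X q * 1 : MvPolynomial (Fin n) ℚ) = 1 := fun q => by ring
      simp only [h1, ite_self, Finset.prod_const_one, one_mul]
      congr 1
      refine Finset.prod_congr rfl fun q _ => ?_
      split_ifs <;> simp
    rw [h, shiftAction_mul, shiftAction_prod_X_pow]
    refine congrArg _ (funext fun q => ?_)
    simp [omitShift]
  · intro i g k
    refine Fin.succAboveCases r ?_ (fun q => ?_) i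
    · simp
    · rw [aeval_X, Fin.insertNth_apply_succAbove, shiftAction_X]
      congr 1
      ext j
      simp [Pi.single_apply]

theorem alphaValue_succ {n : ℕ} (k : Fin (n + 1) → ℤ) :
    alphaValue k = ∑ r : Fin (n + 1), (-1) ^ (r : ℕ) *
      shiftAction (Fin n) (pairOpProd n) (binomialDet 1 n) (omitShift r k) := by
  have h : binomialDet 0 (n + 1) = ∑ r : Fin (n + 1), ((-1 : ℚ) ^ (r : ℕ)) •
      fun k : Fin (n + 1) → ℤ => binomialDet 1 n fun q => k (r.succAbove q) := by
    ext k
    rw [binomialDet_zero_succ]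
    simp
  rw [alphaValue_eq_shiftAction, h, map_sum, Finset.sum_apply]
  refine Finset.sum_congr rfl fun r _ => ?_
  rw [map_smul, Pi.smul_apply, smul_eq_mul, shiftAction_pairOpProd_succAbove]

theorem alphaValue_eq_prod_diff {n : ℕ} (k : Fin n → ℤ) :
    alphaValue k = shiftAction (Fin n) (∏ i, (X i - 1))
      (shiftAction (Fin n) (pairOpProd n) (binomialDet 1 n)) k := by
  rw [← shiftAction_mul, mul_comm, shiftAction_mul, shiftAction_prod_diff_binomialDet,
    alphaValue_eq_shiftAction]

/-! ### Telescoping summation over the rows above a given row -/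

/-- The strictly increasing rows that fit above the row `k` in a monotone triangle. -/
noncomputable def rowsAbove {n : ℕ} (k : Fin (n + 1) → ℤ) : Finset (Fin n → ℤ) :=
  {l ∈ Fintype.piFinset fun i : Fin n => Finset.Icc (k i.castSucc) (k i.succ) | StrictMono l}

theorem mem_rowsAbove {n : ℕ} {k : Fin (n + 1) → ℤ} {l : Fin n → ℤ} :
    l ∈ rowsAbove k ↔ (∀ i : Fin n, k i.castSucc ≤ l i ∧ l i ≤ k i.succ) ∧ StrictMono l := by
  simp [rowsAbove, Fintype.mem_piFinset]

theorem Fin.strictMono_cons_iff {n : ℕ} (x : ℤ) (l : Fin n → ℤ) :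
    StrictMono (Fin.cons x l : Fin (n + 1) → ℤ) ↔ (∀ i, x < l i) ∧ StrictMono l := by
  constructor
  · intro h
    refine ⟨fun i => by simpa using h (Fin.succ_pos i), fun i j hij => ?_⟩
    simpa using h (Fin.succ_lt_succ_iff.2 hij)
  · rintro ⟨h1, h2⟩ i j hij
    induction i using Fin.cases with
    | zero =>
      induction j using Fin.cases with
      | zero => exact absurd hij (lt_irrefl _)
      | succ j => simpa using h1 j
    | succ i =>
      induction j using Fin.cases with
      | zero => exact absurd hij (Fin.not_lt_zero _)
      | succ j => simpa using h2 (Fin.succ_lt_succ_iff.1 hij)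

theorem Fin.monotone_cons_iff {n : ℕ} (x : ℤ) (l : Fin n → ℤ) :
    Monotone (Fin.cons x l : Fin (n + 1) → ℤ) ↔ (∀ i, x ≤ l i) ∧ Monotone l := by
  constructor
  · intro h
    refine ⟨fun i => by simpa using h (Fin.zero_le i.succ), fun i j hij => ?_⟩
    simpa using h (Fin.succ_le_succ_iff.2 hij)
  · rintro ⟨h1, h2⟩ i j hij
    induction i using Fin.cases with
    | zero =>
      induction j using Fin.cases with
      | zero => exact le_rfl
      | succ j => simpa using h1 j
    | succ i =>
      induction j using Fin.cases with
      | zero => exact absurd (le_antisymm hij (Fin.zero_le _)) (Fin.succ_ne_zero _)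
      | succ j => simpa using h2 (Fin.succ_le_succ_iff.1 hij)

/-- The first entry of a row above `(x, y, t)` is either less than `y`, or equal to `y`. -/
theorem cons_mem_rowsAbove {n : ℕ} {x y z : ℤ} {t l : Fin n → ℤ}
    (ht : StrictMono (Fin.cons y t : Fin (n + 1) → ℤ)) (hxy : x ≤ y) :
    (Fin.cons z l : Fin (n + 1) → ℤ) ∈
        rowsAbove (Fin.cons x (Fin.cons y t : Fin (n + 1) → ℤ) : Fin (n + 2) → ℤ) ↔
      (x ≤ z ∧ z < y ∧ l ∈ rowsAbove (Fin.cons y t : Fin (n + 1) → ℤ)) ∨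
      (z = y ∧ l ∈ rowsAbove (Fin.cons (y + 1) t : Fin (n + 1) → ℤ)) := by
  rw [Fin.strictMono_cons_iff] at ht
  simp only [mem_rowsAbove, Fin.strictMono_cons_iff, Fin.forall_fin_succ (n := n), Fin.castSucc_zero,
    Fin.cons_zero, Fin.cons_succ, ← Fin.succ_castSucc]
  cases n with
  | zero =>
    simp [Subsingleton.strictMono]
    omega
  | succ n =>
    simp only [Fin.forall_fin_succ (n := n), Fin.castSucc_zero, Fin.cons_zero, Fin.cons_succ,
      ← Fin.succ_castSucc]
    have h0 := ht.1 0
    constructor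
    · rintro ⟨⟨⟨h1, h2⟩, ⟨h3, h4⟩, h5⟩, ⟨h6, h7⟩, h8⟩
      by_cases hz : z = y
      · exact Or.inr ⟨hz, ⟨⟨by omega, h4⟩, h5⟩, h8⟩
      · exact Or.inl ⟨h1, by omega, ⟨⟨h3, h4⟩, h5⟩, h8⟩
    · have hl : ∀ w, w < l 0 → StrictMono l → w < l 0 ∧ ∀ i : Fin n, w < l i.succ :=
        fun w hw hs => ⟨hw, fun i => hw.trans (hs (Fin.succ_pos i))⟩
      rintro (⟨h1, h2, ⟨⟨h3, h4⟩, h5⟩, h8⟩ | ⟨rfl, ⟨⟨h3, h4⟩, h5⟩, h8⟩)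
      · exact ⟨⟨⟨h1, h2.le⟩, ⟨h3, h4⟩, h5⟩, hl z (by omega) h8, h8⟩
      · exact ⟨⟨⟨hxy, le_rfl⟩, ⟨by omega, h4⟩, h5⟩, hl z (by omega) h8, h8⟩

theorem sum_rowsAbove_cons_cons {n : ℕ} {x y : ℤ} {t : Fin n → ℤ}
    (ht : StrictMono (Fin.cons y t : Fin (n + 1) → ℤ)) (hxy : x ≤ y)
    {M : Type*} [AddCommMonoid M] (f : (Fin (n + 1) → ℤ) → M) :
    ∑ l ∈ rowsAbove (Fin.cons x (Fin.cons y t : Fin (n + 1) → ℤ) : Fin (n + 2) → ℤ), f l =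
      ∑ z ∈ Finset.Ico x y, ∑ l ∈ rowsAbove (Fin.cons y t : Fin (n + 1) → ℤ), f (Fin.cons z l) +
      ∑ l ∈ rowsAbove (Fin.cons (y + 1) t : Fin (n + 1) → ℤ), f (Fin.cons y l) := by
  rw [← Finset.sum_product', ← Finset.sum_filter_add_sum_filter_not _ (fun l => l 0 < y)]
  congr 1
  · refine Finset.sum_nbij' (fun l => (l 0, Fin.tail l)) (fun p => Fin.cons p.1 p.2) ?_ ?_ ?_ ?_ ?_
    · intro l hl
      rw [Finset.mem_filter, ← Fin.cons_self_tail l, cons_mem_rowsAbove ht hxy] at hl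
      simp only [Fin.cons_zero] at hl
      simp only [Finset.mem_product, Finset.mem_Ico]
      rcases hl with ⟨h | h, h'⟩
      · exact ⟨⟨h.1, h.2.1⟩, h.2.2⟩
      · omega
    · rintro ⟨z, l⟩ h
      simp only [Finset.mem_product, Finset.mem_Ico] at h
      rw [Finset.mem_filter, cons_mem_rowsAbove ht hxy]
      exact ⟨Or.inl ⟨h.1.1, h.1.2, h.2⟩, h.1.2⟩
    · simp
    · simp
    · simp
  · refine Finset.sum_nbij' (fun l => (Fin.tail l : Fin n → ℤ)) (fun l => Fin.cons y l) ?_ ?_ ?_ ?_ ?_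
    · intro l hl
      rw [Finset.mem_filter, ← Fin.cons_self_tail l, cons_mem_rowsAbove ht hxy] at hl
      simp only [Fin.cons_zero] at hl
      rcases hl with ⟨h | h, h'⟩
      · omega
      · exact h.2
    · intro l h
      rw [Finset.mem_filter, cons_mem_rowsAbove ht hxy]
      exact ⟨Or.inr ⟨rfl, h⟩, by simp⟩
    · intro l hl
      rw [Finset.mem_filter, ← Fin.cons_self_tail l, cons_mem_rowsAbove ht hxy] at hl
      simp only [Fin.cons_zero] at hl
      rcases hl with ⟨h | h, h'⟩
      · omega
      · conv_rhs => rw [← Fin.cons_self_tail l, h.1]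
    · simp
    · intro l hl
      rw [Finset.mem_filter, ← Fin.cons_self_tail l, cons_mem_rowsAbove ht hxy] at hl
      simp only [Fin.cons_zero] at hl
      rcases hl with ⟨h | h, h'⟩
      · omega
      · conv_lhs => rw [← Fin.cons_self_tail l, h.1]

theorem AdjacentVanishing.cons {n : ℕ} {B : (Fin (n + 1) → ℤ) → ℚ} (hB : AdjacentVanishing B)
    (x : ℤ) : AdjacentVanishing fun l : Fin n → ℤ => B (Fin.cons x l) := by
  have hc : ∀ (l : Fin n → ℤ) (i : Fin n), (Fin.cons x (l + Pi.single i 1) : Fin (n + 1) → ℤ) =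
      Fin.cons x l + Pi.single i.succ 1 := by
    intro l i
    ext j
    induction j using Fin.cases <;> simp [Pi.single_apply]
  intro i j h k hk
  simp only [hc]
  exact hB i.succ j.succ (by simp [h]) _ (by simpa using hk)

theorem shiftAction_prod_diff_cons {n : ℕ} (B : (Fin (n + 1) → ℤ) → ℚ) (x : ℤ) (l : Fin n → ℤ) :
    shiftAction (Fin (n + 1)) (∏ i, (X i - 1)) B (Fin.cons x l) =
      shiftAction (Fin n) (∏ i, (X i - 1)) (fun l => B (Fin.cons (x + 1) l)) l -
        shiftAction (Fin n) (∏ i, (X i - 1)) (fun l => B (Fin.cons x l)) l := by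
  have h : (∏ i : Fin (n + 1), (X i - 1) : MvPolynomial (Fin (n + 1)) ℚ) =
      rename Fin.succ (∏ i : Fin n, (X i - 1)) * (X 0 - 1) := by
    rw [Fin.prod_univ_succ, mul_comm, map_prod]
    simp
  rw [h, shiftAction_mul, shiftAction_rename Fin.succ (fun l : Fin n → ℤ => Fin.cons x l),
    ← Pi.sub_apply, ← map_sub]
  · refine congrFun (congrArg _ (funext fun l => ?_)) l
    rw [map_sub, LinearMap.sub_apply, shiftAction_one, Pi.sub_apply, Pi.sub_apply, shiftAction_X]
    congr 2
    ext j
    induction j using Fin.cases <;> simp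
  · intro i l
    ext j
    induction j using Fin.cases <;> simp [Pi.single_apply]

/-- The value of the summation over the rows above `k` of a function with antidifference `B`. -/
def alternatingOmitSum {n : ℕ} (B : (Fin n → ℤ) → ℚ) (k : Fin (n + 1) → ℤ) : ℚ :=
  ∑ r : Fin (n + 1), (-1) ^ (r : ℕ) * B (omitShift r k)

theorem alternatingOmitSum_cons {n : ℕ} (B : (Fin (n + 1) → ℤ) → ℚ) (x : ℤ)
    (t : Fin (n + 1) → ℤ) :
    alternatingOmitSum B (Fin.cons x t : Fin (n + 2) → ℤ) =
      B (fun i => t i + 1) - alternatingOmitSum (fun l => B (Fin.cons x l)) t := by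
  rw [alternatingOmitSum, Fin.sum_univ_succ, alternatingOmitSum, sub_eq_add_neg,
    ← Finset.sum_neg_distrib]
  congr 1
  · simp only [Fin.val_zero, pow_zero, one_mul]
    refine congrArg B (funext fun i => ?_)
    simp [omitShift]
  · refine Finset.sum_congr rfl fun r _ => ?_
    have : omitShift r.succ (Fin.cons x t : Fin (n + 2) → ℤ) = Fin.cons x (omitShift r t) := by
      ext i
      induction i using Fin.cases <;> simp [omitShift]
    rw [this, Fin.val_succ, pow_succ]
    ring

/-- For each r ≥ 1 the three terms have first coordinates (y, y), (y, y + 1), (y + 1, y + 1) and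
cancel by `AdjacentVanishing`. For r = 0 the omitted entry is the only difference between the rows,
so two terms cancel and one survives. -/
theorem alternatingOmitSum_diagonal {n : ℕ} {B : (Fin (n + 1) → ℤ) → ℚ}
    (hB : AdjacentVanishing B) (y : ℤ) (t : Fin n → ℤ) :
    alternatingOmitSum (fun l => B (Fin.cons y l)) (Fin.cons y t : Fin (n + 1) → ℤ) -
      alternatingOmitSum (fun l => B (Fin.cons y l)) (Fin.cons (y + 1) t : Fin (n + 1) → ℤ) +
      alternatingOmitSum (fun l => B (Fin.cons (y + 1) l)) (Fin.cons (y + 1) t : Fin (n + 1) → ℤ) =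
      B (Fin.cons (y + 1) fun i => t i + 1) := by
  have h0 : ∀ z : ℤ, omitShift 0 (Fin.cons z t : Fin (n + 1) → ℤ) = fun i => t i + 1 := by
    intro z
    ext i
    simp [omitShift]
  simp only [alternatingOmitSum, Fin.sum_univ_succ, Fin.val_zero, pow_zero, one_mul, h0]
  have h1 : ∀ r : Fin n,
      B (Fin.cons y (omitShift r.succ (Fin.cons y t : Fin (n + 1) → ℤ))) -
      B (Fin.cons y (omitShift r.succ (Fin.cons (y + 1) t : Fin (n + 1) → ℤ))) +
      B (Fin.cons (y + 1) (omitShift r.succ (Fin.cons (y + 1) t : Fin (n + 1) → ℤ))) = 0 := by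
    intro r
    cases n with
    | zero => exact r.elim0
    | succ n =>
      have h2 : ∀ z : ℤ, omitShift r.succ (Fin.cons z t : Fin (n + 2) → ℤ) =
          Fin.cons z (omitShift r t) := by
        intro z
        ext i
        induction i using Fin.cases <;> simp [omitShift]
      simp only [h2]
      have h3 := hB 0 (Fin.succ 0) (by simp) (Fin.cons y (Fin.cons y (omitShift r t))) (by
        rw [Fin.cons_succ, Fin.cons_zero, Fin.cons_zero])
      convert h3 using 3
      · congr 1
        ext i
        refine Fin.cases ?_ (fun i => Fin.cases ?_ (fun i => ?_) i) i <;>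
          simp [Fin.ext_iff]
      · ext i
        refine Fin.cases ?_ (fun i => Fin.cases ?_ (fun i => ?_) i) i <;>
          simp [Fin.ext_iff]
  have h4 := Finset.sum_congr rfl fun (r : Fin n) (_ : r ∈ Finset.univ) =>
    congrArg (fun c : ℚ => (-1) ^ ((r.succ : Fin (n + 1)) : ℕ) * c) (h1 r)
  simp only [mul_add, mul_sub, Finset.sum_add_distrib, Finset.sum_sub_distrib, mul_zero,
    Finset.sum_const_zero] at h4
  linarith

theorem Finset.sum_Ico_int_telescope {x y : ℤ} (h : x ≤ y) (F : ℤ → ℚ) :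
    ∑ z ∈ Finset.Ico x y, F (z + 1) - ∑ z ∈ Finset.Ico x y, F z = F y - F x := by
  obtain ⟨m, rfl⟩ := Int.le.dest h
  clear h
  induction m with
  | zero => simp
  | succ m ih =>
    have h1 : Finset.Ico x (x + ((m + 1 : ℕ) : ℤ)) = insert (x + m) (Finset.Ico x (x + m)) := by
      ext z
      simp only [Finset.mem_Ico, Finset.mem_insert]
      omega
    rw [h1, Finset.sum_insert (by simp), Finset.sum_insert (by simp), Nat.cast_succ, ← add_assoc]
    linarith

/-- Induction on the length, splitting by whether the first entry z of the row above is less than y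
or equal to y. The sum over z < y telescopes, and the boundary terms at y combine by
`alternatingOmitSum_diagonal`. -/
theorem sum_rowsAbove_prod_diff {n : ℕ} {B : (Fin n → ℤ) → ℚ} (hB : AdjacentVanishing B)
    (k : Fin (n + 1) → ℤ) (hk : Monotone k) (hk' : StrictMono (Fin.tail k)) :
    ∑ l ∈ rowsAbove k, shiftAction (Fin n) (∏ i, (X i - 1)) B l = alternatingOmitSum B k := by
  induction n with
  | zero =>
    have : rowsAbove k = {Fin.elim0} := by
      ext l
      simp [mem_rowsAbove, Subsingleton.strictMono, Subsingleton.elim l Fin.elim0]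
    rw [this, Finset.sum_singleton, Finset.univ_eq_empty, Finset.prod_empty, shiftAction_one,
      alternatingOmitSum]
    simp [Subsingleton.elim (omitShift 0 k) Fin.elim0]
  | succ n ih =>
    obtain ⟨x, k, rfl⟩ : ∃ x k', k = Fin.cons x k' := ⟨_, _, (Fin.cons_self_tail k).symm⟩
    obtain ⟨y, t, rfl⟩ : ∃ y t, k = Fin.cons y t := ⟨_, _, (Fin.cons_self_tail k).symm⟩
    rw [Fin.tail_cons] at hk'
    have hxy : x ≤ y := by simpa using hk (Fin.zero_le 1)
    have hy := (Fin.strictMono_cons_iff _ _).1 hk'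
    have ih1 : ∀ z, ∑ l ∈ rowsAbove (Fin.cons y t : Fin (n + 1) → ℤ),
        shiftAction (Fin n) (∏ i, (X i - 1)) (fun l => B (Fin.cons z l)) l =
        alternatingOmitSum (fun l => B (Fin.cons z l)) (Fin.cons y t : Fin (n + 1) → ℤ) :=
      fun z => ih (hB.cons z) _ hk'.monotone (by simpa using hy.2)
    -- The row (y + 1, t) may have y + 1 equal to the first entry of t; the induction therefore
    -- allows a weak first inequality.
    have ih2 : ∀ z, ∑ l ∈ rowsAbove (Fin.cons (y + 1) t : Fin (n + 1) → ℤ),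
        shiftAction (Fin n) (∏ i, (X i - 1)) (fun l => B (Fin.cons z l)) l =
        alternatingOmitSum (fun l => B (Fin.cons z l)) (Fin.cons (y + 1) t : Fin (n + 1) → ℤ) :=
      fun z => ih (hB.cons z) _ ((Fin.monotone_cons_iff _ _).2
        ⟨fun i => hy.1 i, hy.2.monotone⟩) (by simpa using hy.2)
    rw [sum_rowsAbove_cons_cons hk' hxy, alternatingOmitSum_cons]
    simp only [shiftAction_prod_diff_cons, Finset.sum_sub_distrib, ih1, ih2]
    rw [Finset.sum_Ico_int_telescope hxy fun z => alternatingOmitSum (fun l => B (Fin.cons z l)) (Fin.cons y t : Fin (n + 1) → ℤ)]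
    have h := alternatingOmitSum_diagonal hB y t
    have h5 : (fun i => (Fin.cons y t : Fin (n + 1) → ℤ) i + 1) =
        Fin.cons (y + 1) fun i => t i + 1 := by
      ext i
      induction i using Fin.cases <;> simp
    rw [h5]
    linarith

/-! ### Recursions for α -/

theorem alphaValue_succ_eq_alternatingOmitSum {n : ℕ} (k : Fin (n + 1) → ℤ) :
    alphaValue k =
      alternatingOmitSum (shiftAction (Fin n) (pairOpProd n) (binomialDet 1 n)) k :=
  alphaValue_succ k

theorem alphaValue_eq_sum_rowsAbove {n : ℕ} (k : Fin (n + 1) → ℤ) (hk : StrictMono k) :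
    alphaValue k = ∑ l ∈ rowsAbove k, alphaValue l := by
  rw [alphaValue_succ_eq_alternatingOmitSum,
    ← sum_rowsAbove_prod_diff (adjacentVanishing_shiftAction 1 n) k hk.monotone
      (hk.comp Fin.strictMono_succ)]
  exact Finset.sum_congr rfl fun l _ => (alphaValue_eq_prod_diff l).symm

/-- The term of the alternating sum that omits the first entry does not depend on x and drops out;
the rest is the telescoped sum over rows above t. No inequality between x and t is needed. -/
theorem alphaValue_cons_sub {n : ℕ} (t : Fin (n + 1) → ℤ) (ht : StrictMono t) (x : ℤ) :
    alphaValue (Fin.cons x t : Fin (n + 2) → ℤ) - alphaValue (Fin.cons (x + 1) t : Fin (n + 2) → ℤ) =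
      ∑ l ∈ rowsAbove t, alphaValue (Fin.cons x l : Fin (n + 1) → ℤ) := by
  have hB := adjacentVanishing_shiftAction 1 (n + 1)
  have h : ∀ y, _ := fun y => sum_rowsAbove_prod_diff (hB.cons y) t ht.monotone
    (ht.comp Fin.strictMono_succ)
  simp only [alphaValue_succ_eq_alternatingOmitSum (n := n + 1), alternatingOmitSum_cons, ← h,
    alphaValue_eq_prod_diff (n := n + 1), shiftAction_prod_diff_cons, Finset.sum_sub_distrib]
  ring

/-! ### Building monotone triangles row by row -/

/-- Adding the bottom row `k` to a triangular array. -/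
def snocRow {n : ℕ} (b : (i : Fin n) → Fin ((i : ℕ) + 1) → ℤ) (k : Fin (n + 1) → ℤ) :
    (i : Fin (n + 1)) → Fin ((i : ℕ) + 1) → ℤ :=
  Fin.snoc (α := fun i : Fin (n + 1) => Fin ((i : ℕ) + 1) → ℤ) b k

theorem snocRow_castSucc {n : ℕ} (b : (i : Fin n) → Fin ((i : ℕ) + 1) → ℤ) (k : Fin (n + 1) → ℤ)
    (i : Fin n) : snocRow b k i.castSucc = b i :=
  Fin.snoc_castSucc (α := fun i : Fin (n + 1) => Fin ((i : ℕ) + 1) → ℤ) k b i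

theorem snocRow_last {n : ℕ} (b : (i : Fin n) → Fin ((i : ℕ) + 1) → ℤ) (k : Fin (n + 1) → ℤ) :
    snocRow b k (Fin.last n) = k :=
  Fin.snoc_last (α := fun i : Fin (n + 1) => Fin ((i : ℕ) + 1) → ℤ) k b

theorem snocRow_injective {n : ℕ} (k : Fin (n + 1) → ℤ) :
    Function.Injective fun b => snocRow b k := by
  intro b b' h
  funext i
  rw [← snocRow_castSucc b k, ← snocRow_castSucc b' k]
  exact congrFun h i.castSucc

theorem eq_of_mem_monotoneTriangles {n : ℕ} {l l' : Fin n → ℤ}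
    {b : (i : Fin n) → Fin ((i : ℕ) + 1) → ℤ} (h : b ∈ monotoneTriangles l)
    (h' : b ∈ monotoneTriangles l') : l = l' := by
  ext j
  have hn : n - 1 + 1 = n := Nat.sub_add_cancel (by have := j.2; omega)
  have h1 := h.2 ⟨n - 1, by omega⟩ ⟨j, by simp only [hn]; exact j.2⟩ hn
  have h2 := h'.2 ⟨n - 1, by omega⟩ ⟨j, by simp only [hn]; exact j.2⟩ hn
  exact h1.symm.trans h2

theorem snocRow_mem_monotoneTriangles {n : ℕ} {k : Fin (n + 1) → ℤ} (hk : StrictMono k)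
    {l : Fin n → ℤ} (hl : l ∈ rowsAbove k) {b : (i : Fin n) → Fin ((i : ℕ) + 1) → ℤ}
    (hb : b ∈ monotoneTriangles l) : snocRow b k ∈ monotoneTriangles k := by
  refine ⟨⟨fun i => ?_, fun i i' hi j => ?_⟩, fun i j hi => ?_⟩
  · induction i using Fin.lastCases with
    | last => rw [snocRow_last]; exact hk
    | cast i => rw [snocRow_castSucc]; exact hb.1.1 i
  · induction i using Fin.lastCases with
    | last => exact absurd i'.2 (by rw [hi]; simp)
    | cast i =>
      rw [snocRow_castSucc]
      induction i' using Fin.lastCases with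
      | last =>
        rw [snocRow_last, hb.2 i j (by simpa using hi.symm)]
        exact (mem_rowsAbove.1 hl).1 ⟨j, _⟩
      | cast i' =>
        rw [snocRow_castSucc]
        exact hb.1.2 i i' hi j
  · obtain rfl : i = Fin.last n := Fin.ext (by simpa using hi)
    rw [snocRow_last]
    rfl

theorem exists_snocRow_of_mem_monotoneTriangles {n : ℕ} {k : Fin (n + 1) → ℤ}
    {a : (i : Fin (n + 1)) → Fin ((i : ℕ) + 1) → ℤ} (ha : a ∈ monotoneTriangles k) :
    ∃ l ∈ rowsAbove k, ∃ b ∈ monotoneTriangles l, snocRow b k = a := by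
  have hlast : a (Fin.last n) = k := funext fun j => ha.2 (Fin.last n) j rfl
  obtain ⟨l, hl⟩ : ∃ l : Fin n → ℤ, ∀ (i : Fin n) (j : Fin ((i : ℕ) + 1)) (hi : (i : ℕ) + 1 = n),
      a i.castSucc j = l ⟨j, by omega⟩ := by
    cases n with
    | zero => exact ⟨Fin.elim0, fun i => i.elim0⟩
    | succ n =>
      refine ⟨a (Fin.last n).castSucc, fun i j hi => ?_⟩
      obtain rfl : i = Fin.last n := Fin.ext (by simpa using hi)
      rfl
  -- The outer index j serves only to ensure n ≠ 0, so that a penultimate row exists.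
  have hl' : ∀ (j : Fin n), ∃ (i : Fin n) (hi : (i : ℕ) + 1 = n),
      ∀ j : Fin n, l j = a i.castSucc ⟨j, by simp [hi]⟩ := by
    intro j
    have hn : n - 1 + 1 = n := Nat.sub_add_cancel (by have := j.2; omega)
    exact ⟨⟨n - 1, by omega⟩, hn,
      fun j => (hl ⟨n - 1, by omega⟩ ⟨j, by simp only [hn]; exact j.2⟩ hn).symm⟩
  refine ⟨l, mem_rowsAbove.2 ⟨fun j => ?_, fun j j' hj => ?_⟩, fun i => a i.castSucc,
    ⟨⟨fun i => ha.1.1 i.castSucc, fun i i' hi j => ha.1.2 i.castSucc i'.castSucc hi j⟩, hl⟩, ?_⟩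
  · obtain ⟨i, hi, h⟩ := hl' j
    have := ha.1.2 i.castSucc (Fin.last n) hi.symm ⟨j, by simp [hi]⟩
    rw [hlast, ← h] at this
    exact this
  · obtain ⟨i, hi, h⟩ := hl' j
    rw [h, h]
    exact ha.1.1 i.castSucc hj
  · funext i
    induction i using Fin.lastCases with
    | last => rw [snocRow_last, hlast]
    | cast i => rw [snocRow_castSucc]

/-- The monotone triangles with a given strictly increasing bottom row, as a finite set. -/
noncomputable def triangleFinset : {n : ℕ} → (Fin n → ℤ) →
    Finset ((i : Fin n) → Fin ((i : ℕ) + 1) → ℤ)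
  | 0, _ => {fun i => i.elim0}
  | _ + 1, k => (rowsAbove k).biUnion fun l => (triangleFinset l).image fun b => snocRow b k

theorem mem_triangleFinset {n : ℕ} {k : Fin n → ℤ} (hk : StrictMono k)
    {a : (i : Fin n) → Fin ((i : ℕ) + 1) → ℤ} :
    a ∈ triangleFinset k ↔ a ∈ monotoneTriangles k := by
  induction n with
  | zero =>
    simp only [triangleFinset, Finset.mem_singleton]
    exact iff_of_true (funext fun i => i.elim0)
      ⟨⟨fun i => i.elim0, fun i => i.elim0⟩, fun i => i.elim0⟩
  | succ n ih =>
    simp only [triangleFinset, Finset.mem_biUnion, Finset.mem_image]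
    constructor
    · rintro ⟨l, hl, b, hb, rfl⟩
      exact snocRow_mem_monotoneTriangles hk hl ((ih (mem_rowsAbove.1 hl).2).1 hb)
    · intro ha
      obtain ⟨l, hl, b, hb, rfl⟩ := exists_snocRow_of_mem_monotoneTriangles ha
      exact ⟨l, hl, b, (ih (mem_rowsAbove.1 hl).2).2 hb, rfl⟩

theorem card_filter_triangleFinset_succ {n : ℕ} (k : Fin (n + 1) → ℤ)
    (p : ((i : Fin (n + 1)) → Fin ((i : ℕ) + 1) → ℤ) → Prop) [DecidablePred p] :
    ((triangleFinset k).filter p).card =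
      ∑ l ∈ rowsAbove k, ((triangleFinset l).filter fun b => p (snocRow b k)).card := by
  rw [triangleFinset, Finset.filter_biUnion, Finset.card_biUnion]
  · refine Finset.sum_congr rfl fun l _ => ?_
    rw [Finset.filter_image, Finset.card_image_of_injective _ (snocRow_injective k)]
  · intro l hl l' hl' hne
    refine Finset.disjoint_left.2 fun a ha ha' => hne ?_
    simp only [Finset.mem_filter, Finset.mem_image] at ha ha'
    obtain ⟨⟨b, hb, rfl⟩, -⟩ := ha
    obtain ⟨⟨b', hb', h⟩, -⟩ := ha'
    obtain rfl := snocRow_injective k h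
    exact eq_of_mem_monotoneTriangles ((mem_triangleFinset (mem_rowsAbove.1 hl).2).1 hb)
      ((mem_triangleFinset (mem_rowsAbove.1 hl').2).1 hb')

theorem alphaValue_of_isEmpty (k : Fin 0 → ℤ) : alphaValue k = 1 := by
  rw [alphaValue_eq_shiftAction, pairOpProd, Finset.univ_eq_empty, Finset.prod_empty,
    shiftAction_one, binomialDet, Matrix.det_isEmpty]

theorem alphaValue_eq_card {n : ℕ} (k : Fin n → ℤ) (hk : StrictMono k) :
    alphaValue k = ((triangleFinset k).card : ℚ) := by
  induction n with
  | zero => rw [alphaValue_of_isEmpty, triangleFinset]; simp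
  | succ n ih =>
    have h := card_filter_triangleFinset_succ k fun _ => True
    simp only [Finset.filter_true] at h
    rw [alphaValue_eq_sum_rowsAbove k hk, h, Nat.cast_sum]
    exact Finset.sum_congr rfl fun l hl => ih l (mem_rowsAbove.1 hl).2

/-! ### Entries on the left-most diagonal -/

theorem leftDiagonalCount_snocRow {n : ℕ} (c : ℤ) (b : (i : Fin n) → Fin ((i : ℕ) + 1) → ℤ)
    (k : Fin (n + 1) → ℤ) :
    leftDiagonalCount c (snocRow b k) = leftDiagonalCount c b + if k 0 = c then 1 else 0 := by
  rw [leftDiagonalCount, leftDiagonalCount, Finset.card_filter, Finset.card_filter,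
    Fin.sum_univ_castSucc]
  congr 1
  · exact Finset.sum_congr rfl fun i _ => by rw [snocRow_castSucc]
  · rw [snocRow_last]

theorem le_of_mem_triangleFinset {n : ℕ} {k : Fin (n + 1) → ℤ}
    {a : (i : Fin (n + 1)) → Fin ((i : ℕ) + 1) → ℤ} (ha : a ∈ triangleFinset k)
    (i : Fin (n + 1)) : k 0 ≤ a i 0 := by
  induction n with
  | zero =>
    obtain rfl : i = Fin.last 0 := Fin.ext (by omega)
    rw [triangleFinset, Finset.mem_biUnion] at ha
    obtain ⟨l, -, ha⟩ := ha
    obtain ⟨b, -, rfl⟩ := Finset.mem_image.1 ha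
    rw [snocRow_last]
  | succ n ih =>
    rw [triangleFinset, Finset.mem_biUnion] at ha
    obtain ⟨l, hl, ha⟩ := ha
    obtain ⟨b, hb, rfl⟩ := Finset.mem_image.1 ha
    induction i using Fin.lastCases with
    | last => rw [snocRow_last]
    | cast i =>
      rw [snocRow_castSucc]
      exact ((mem_rowsAbove.1 hl).1 0).1.trans (ih hb i)

theorem leftDiagonalCount_eq_zero {n : ℕ} {c : ℤ} {l : Fin (n + 1) → ℤ} (hc : c < l 0)
    {b : (i : Fin (n + 1)) → Fin ((i : ℕ) + 1) → ℤ} (hb : b ∈ triangleFinset l) :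
    leftDiagonalCount c b = 0 := by
  rw [leftDiagonalCount, Finset.card_eq_zero, Finset.filter_eq_empty_iff]
  exact fun i _ h => (hc.trans_le (le_of_mem_triangleFinset hb i)).ne' h

theorem sum_rowsAbove_first_eq {n : ℕ} {x : ℤ} {t : Fin (n + 1) → ℤ}
    (ht : StrictMono (Fin.cons x t : Fin (n + 2) → ℤ)) {M : Type*} [AddCommMonoid M]
    (f : (Fin (n + 1) → ℤ) → M)
    (hf : ∀ l ∈ rowsAbove (Fin.cons x t : Fin (n + 2) → ℤ), x < l 0 → f l = 0) :
    ∑ l ∈ rowsAbove (Fin.cons x t : Fin (n + 2) → ℤ), f l =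
      ∑ l ∈ rowsAbove t, f (Fin.cons x l) := by
  have hx := (Fin.strictMono_cons_iff _ _).1 ht
  obtain ⟨y, t, rfl⟩ : ∃ y t', t = Fin.cons y t' := ⟨_, _, (Fin.cons_self_tail t).symm⟩
  have hxy : x < y := by simpa using hx.1 0
  have h0 : ∀ z l, (Fin.cons z l : Fin (n + 1) → ℤ) ∈
      rowsAbove (Fin.cons x (Fin.cons y t : Fin (n + 1) → ℤ) : Fin (n + 2) → ℤ) → x < z →
      f (Fin.cons z l) = 0 := fun z l hl hz => hf _ hl (by simpa using hz)
  simp only [cons_mem_rowsAbove hx.2 hxy.le] at h0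
  rw [sum_rowsAbove_cons_cons hx.2 hxy.le, Finset.sum_eq_single x,
    Finset.sum_eq_zero (s := rowsAbove (Fin.cons (y + 1) t : Fin (n + 1) → ℤ)), add_zero]
  · exact fun l hl => h0 y l (Or.inr ⟨rfl, hl⟩) hxy
  · intro z hz hzx
    have := Finset.mem_Ico.1 hz
    exact Finset.sum_eq_zero fun l hl =>
      h0 z l (Or.inl ⟨this.1, this.2, hl⟩) (lt_of_le_of_ne this.1 (Ne.symm hzx))
  · exact fun h => absurd (Finset.mem_Ico.2 ⟨le_rfl, hxy⟩) h

/-- Entries weakly increase up the left-most diagonal, so the copies of x form a run from the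
bottom. A run longer than one forces the next row to be (x, l) with l above t, and these are the
rows over which `alphaValue_cons_sub` sums; induction removes one entry at a time. -/
theorem iterate_fwdDiff_alphaValue_eq_card {n : ℕ} (i : ℕ) (t : Fin n → ℤ) (x : ℤ)
    (ht : StrictMono (Fin.cons x t : Fin (n + 1) → ℤ)) :
    (-1) ^ i * (fwdDiff (1 : ℤ))^[i] (fun y => alphaValue (Fin.cons y t : Fin (n + 1) → ℤ)) x =
      (((triangleFinset (Fin.cons x t : Fin (n + 1) → ℤ)).filter
        fun a => i + 1 ≤ leftDiagonalCount x a).card : ℚ) := by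
  induction i generalizing n with
  | zero =>
    rw [pow_zero, one_mul, Function.iterate_zero, id, alphaValue_eq_card _ ht]
    congr 2
    symm
    rw [Finset.filter_eq_self]
    intro a ha
    rw [triangleFinset, Finset.mem_biUnion] at ha
    obtain ⟨l, hl, ha⟩ := ha
    obtain ⟨b, hb, rfl⟩ := Finset.mem_image.1 ha
    simp [leftDiagonalCount_snocRow]
  | succ i ih =>
    rw [card_filter_triangleFinset_succ]
    simp only [leftDiagonalCount_snocRow, Fin.cons_zero, if_true, add_le_add_iff_right]
    rw [Function.iterate_succ_apply]
    cases n with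
    | zero =>
      have h1 : fwdDiff (1 : ℤ) (fun y => alphaValue (Fin.cons y t : Fin 1 → ℤ)) = fun _ => 0 := by
        ext y
        have h2 : ∀ z : ℤ, alphaValue (Fin.cons z t : Fin 1 → ℤ) = 1 := by
          intro z
          rw [alphaValue_succ]
          simp [pairOpProd, binomialDet]
        simp [fwdDiff, h2]
      rw [h1]
      have h3 : (fwdDiff (1 : ℤ))^[i] (fun _ => (0 : ℚ)) = fun _ => 0 :=
        Function.iterate_fixed (fwdDiff_const 1 0) i
      rw [h3, mul_zero, Finset.sum_eq_zero, Nat.cast_zero]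
      intro l _
      rw [Finset.card_eq_zero, Finset.filter_eq_empty_iff]
      intro b _
      simp [leftDiagonalCount]
    | succ n =>
      have htt := ((Fin.strictMono_cons_iff _ _).1 ht)
      have h1 : fwdDiff (1 : ℤ) (fun y => alphaValue (Fin.cons y t : Fin (n + 2) → ℤ)) =
          ∑ l ∈ rowsAbove t, (-1 : ℚ) • fun y => alphaValue (Fin.cons y l : Fin (n + 1) → ℤ) := by
        ext y
        have := alphaValue_cons_sub t htt.2 y
        rw [Finset.sum_apply]
        simp only [fwdDiff, Pi.smul_apply, smul_eq_mul, ← Finset.mul_sum, ← this]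
        ring
      rw [h1, fwdDiff_iter_finsetSum, Finset.sum_apply]
      simp only [fwdDiff_iter_const_smul, Pi.smul_apply, smul_eq_mul]
      rw [sum_rowsAbove_first_eq ht, Nat.cast_sum, Finset.mul_sum]
      · refine Finset.sum_congr rfl fun l hl => ?_
        rw [← ih l]
        · ring
        · refine (Fin.strictMono_cons_iff _ _).2 ⟨fun j => ?_, (mem_rowsAbove.1 hl).2⟩
          exact (htt.1 _).trans_le ((mem_rowsAbove.1 hl).1 j).1
      · intro l hl hx
        rw [Finset.card_eq_zero, Finset.filter_eq_empty_iff]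
        intro b hb
        rw [leftDiagonalCount_eq_zero hx hb]
        omega

/-- The bottom row `(x, 2d, 3d, …, (n + 1)d)`. -/
theorem refinedRow_eq_cons (n : ℕ) (d x : ℤ) :
    (fun j : Fin (n + 1) => if (j : ℕ) = 0 then x else ((j : ℕ) + 1 : ℤ) * d) =
      Fin.cons x fun j : Fin n => ((j : ℕ) + 2 : ℤ) * d := by
  ext j
  induction j using Fin.cases with
  | zero => simp
  | succ j =>
    rw [if_neg (by simp), Fin.cons_succ, Fin.val_succ]
    push_cast
    ring

theorem refinedNumber_eq_card (n : ℕ) (d : ℤ) (hd : 1 ≤ d) (i : ℕ) :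
    refinedNumber (n + 1) d i =
      (((triangleFinset (fun j : Fin (n + 1) => ((j : ℕ) + 1 : ℤ) * d)).filter
        fun a => leftDiagonalCount d a = i + 1).card : ℚ) := by
  have hrow : (fun j : Fin (n + 1) => ((j : ℕ) + 1 : ℤ) * d) =
      Fin.cons d fun j : Fin n => ((j : ℕ) + 2 : ℤ) * d := by
    rw [← refinedRow_eq_cons]
    ext j
    split_ifs with h <;> simp [h]
  have hs : StrictMono (Fin.cons d fun j : Fin n => ((j : ℕ) + 2 : ℤ) * d : Fin (n + 1) → ℤ) := by
    rw [← hrow]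
    intro a b hab
    have : ((a : ℕ) : ℤ) < (b : ℕ) := by exact_mod_cast hab
    simp only
    nlinarith
  have h1 := iterate_fwdDiff_alphaValue_eq_card i _ d hs
  have h2 := iterate_fwdDiff_alphaValue_eq_card (i + 1) _ d hs
  -- The value at d + 1 is the value at d plus the next difference; with the signs this subtracts
  -- the triangles with at least i + 2 entries from those with at least i + 1.
  rw [Function.iterate_succ_apply', fwdDiff, pow_succ] at h2
  rw [refinedNumber]
  simp only [refinedRow_eq_cons]
  rw [hrow]
  set T := triangleFinset (Fin.cons d fun j : Fin n => ((j : ℕ) + 2 : ℤ) * d : Fin (n + 1) → ℤ)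
  have h3 : (T.filter fun a => i + 1 ≤ leftDiagonalCount d a).card =
      (T.filter fun a => leftDiagonalCount d a = i + 1).card +
      (T.filter fun a => i + 1 + 1 ≤ leftDiagonalCount d a).card := by
    rw [← Finset.card_union_of_disjoint, ← Finset.filter_or]
    · congr 1
      refine Finset.filter_congr fun a _ => ?_
      omega
    · refine Finset.disjoint_filter.2 fun a _ h => ?_
      omega
  rw [h3, Nat.cast_add] at h1
  linarith

theorem refinedNumber_eq_zero (n : ℕ) (d : ℤ) (hd : 1 ≤ d) (i : ℕ) (hi : n < i) :
    refinedNumber (n + 1) d i = 0 := by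
  rw [refinedNumber_eq_card n d hd, Nat.cast_eq_zero, Finset.card_eq_zero,
    Finset.filter_eq_empty_iff]
  intro a _
  have : leftDiagonalCount d a ≤ n + 1 := by
    simpa [leftDiagonalCount] using Finset.card_filter_le (Finset.univ : Finset (Fin (n + 1))) _
  omega

/-! ### Symmetric functions of differences and the rotation rule -/

/-- The product ∏ (1 + z Δ_{k_i}) fixes the Vandermonde determinant for every z, so its coefficients
at positive powers of z act as zero. -/
theorem shiftAction_esymm_diff_binomialDet (n j : ℕ) (hj : j ≠ 0) :
    shiftAction (Fin n) (∑ s ∈ Finset.powersetCard j Finset.univ, ∏ i ∈ s, (X i - 1))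
      (binomialDet 0 n) = 0 := by
  by_cases hjn : n < j
  · rw [Finset.powersetCard_eq_empty.2 (by simpa using hjn)]
    simp
  ext k
  set e : ℕ → MvPolynomial (Fin n) ℚ := fun j =>
    ∑ s ∈ Finset.powersetCard j Finset.univ, ∏ i ∈ s, (X i - 1) with he
  set a : ℕ → ℚ := fun j => shiftAction (Fin n) (e j) (binomialDet 0 n) k with ha
  have h1 : ∀ z : ℚ, (∏ i : Fin n, (1 + C z * (X i - 1)) : MvPolynomial (Fin n) ℚ) =
      ∑ j ∈ Finset.range (n + 1), C (z ^ j) * e j := by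
    intro z
    rw [Finset.prod_one_add, Finset.sum_powerset, Finset.card_univ, Fintype.card_fin]
    refine Finset.sum_congr rfl fun j _ => ?_
    rw [he, Finset.mul_sum]
    refine Finset.sum_congr rfl fun s hs => ?_
    rw [Finset.prod_mul_distrib, Finset.prod_const, (Finset.mem_powersetCard.1 hs).2, map_pow]
  have h2 : ∀ z : ℚ, ∑ j ∈ Finset.range (n + 1), a j * z ^ j = binomialDet 0 n k := by
    intro z
    have := congrFun (shiftAction_prod_one_add_smul_diff_binomialDet n z) k
    rw [h1, map_sum, LinearMap.sum_apply, Finset.sum_apply] at this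
    rw [← this]
    refine Finset.sum_congr rfl fun j _ => ?_
    rw [shiftAction_mul, shiftAction_C, Pi.smul_apply, smul_eq_mul, mul_comm]
  have h3 : (∑ j ∈ Finset.range (n + 1), Polynomial.C (a j) * Polynomial.X ^ j) =
      Polynomial.C (binomialDet 0 n k) := by
    refine Polynomial.funext fun z => ?_
    simp [Polynomial.eval_finsetSum, h2]
  have h4 := congrArg (fun p => Polynomial.coeff p j) h3
  simp only [Polynomial.finsetSum_coeff, Polynomial.coeff_C_mul_X_pow, Polynomial.coeff_C,
    if_neg hj] at h4
  rw [Finset.sum_ite_eq, if_pos (by simp; omega)] at h4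
  exact h4

/-- Elementary symmetric polynomials in the differences annihilate the Vandermonde determinant. -/
theorem shiftAction_prod_add_mul_diff_binomialDet (n : ℕ) (a b : MvPolynomial (Fin n) ℚ) :
    shiftAction (Fin n) (∏ i, (a + b * (X i - 1))) (binomialDet 0 n) =
      shiftAction (Fin n) (a ^ n) (binomialDet 0 n) := by
  have h1 : ∏ i, (a + b * (X i - 1)) = ∑ j ∈ Finset.range (n + 1), (b ^ j * a ^ (n - j)) *
      ∑ s ∈ Finset.powersetCard j Finset.univ, ∏ i ∈ s, (X i - 1) := by
    simp only [add_comm a]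
    rw [Finset.prod_add, Finset.sum_powerset, Finset.card_univ, Fintype.card_fin]
    refine Finset.sum_congr rfl fun j _ => ?_
    rw [Finset.mul_sum]
    refine Finset.sum_congr rfl fun s hs => ?_
    have hs := (Finset.mem_powersetCard.1 hs).2
    rw [Finset.prod_mul_distrib, Finset.prod_const, Finset.prod_const,
      Finset.card_sdiff_of_subset (Finset.subset_univ s), hs, Finset.card_univ, Fintype.card_fin]
    ring
  rw [h1, map_sum, LinearMap.sum_apply, Finset.sum_eq_single 0]
  · simp
  · intro j _ hj
    rw [shiftAction_mul, shiftAction_esymm_diff_binomialDet n j hj, map_zero]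
  · simp

/-- Including q = 0 makes both products symmetric in all the differences. Since id - E_0 + E_0 E_q =
1 + E_0 Δ_q and id - E_q + E_q E_0 = E_0 + (E_0 - 1) Δ_q, the completed products act on the
determinant as 1 and E_0^(n + 1). The common extra factor `pairOp 0 0` is traded between them
without division. -/
theorem shiftAction_prod_pairOp_zero (n : ℕ) :
    shiftAction (Fin (n + 1)) (∏ q : Fin n, pairOp q.succ 0) (binomialDet 0 (n + 1)) =
      shiftAction (Fin (n + 1)) (X 0 ^ (n + 1) * ∏ q : Fin n, pairOp 0 q.succ)
        (binomialDet 0 (n + 1)) := by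
  set V := binomialDet 0 (n + 1)
  set U : MvPolynomial (Fin (n + 1)) ℚ := ∏ q : Fin n, pairOp 0 q.succ with hU
  set T : MvPolynomial (Fin (n + 1)) ℚ := ∏ q : Fin n, pairOp q.succ 0 with hT
  have h1 : shiftAction _ (U * pairOp 0 0) V = V := by
    have h := shiftAction_prod_add_mul_diff_binomialDet (n + 1) 1 (X 0)
    rw [one_pow, shiftAction_one] at h
    refine Eq.trans ?_ h
    rw [mul_comm, hU, ← Fin.prod_univ_succ (fun q => pairOp 0 q)]
    refine congrArg (fun P => shiftAction _ P V) (Finset.prod_congr rfl fun q _ => ?_)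
    rw [pairOp]
    ring
  have h2 : shiftAction _ (pairOp 0 0 * T) V = shiftAction _ (X 0 ^ (n + 1)) V := by
    rw [← shiftAction_prod_add_mul_diff_binomialDet (n + 1) (X 0) (X 0 - 1), hT,
      ← Fin.prod_univ_succ (fun q => pairOp q 0)]
    refine congrArg (fun P => shiftAction _ P V) (Finset.prod_congr rfl fun q _ => ?_)
    rw [pairOp]
    ring
  conv_lhs => rw [← h1]
  rw [← shiftAction_mul, show T * (U * pairOp 0 0) = U * (pairOp 0 0 * T) by ring,
    shiftAction_mul, h2, ← shiftAction_mul, mul_comm]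

theorem pairOpProd_succ (n : ℕ) :
    pairOpProd (n + 1) = rename Fin.succ (pairOpProd n) * ∏ q : Fin n, pairOp 0 q.succ := by
  simp only [pairOpProd, Fin.prod_univ_succ, if_false, one_mul, Fin.succ_pos, if_true,
    Fin.not_lt_zero, Fin.succ_lt_succ_iff, map_prod, apply_ite (rename _), map_one, rename_pairOp]
  rw [mul_comm]

theorem rename_finRotate_pairOpProd (n : ℕ) :
    rename (finRotate (n + 1)) (pairOpProd (n + 1)) =
      rename Fin.succ (pairOpProd n) * ∏ q : Fin n, pairOp q.succ 0 := by
  have h : ∀ p : Fin n, finRotate (n + 1) p.castSucc = p.succ := fun p => by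
    rw [finRotate_apply, Fin.coeSucc_eq_succ]
  simp only [pairOpProd, Fin.prod_univ_castSucc (n := n), map_mul, map_prod, apply_ite (rename _),
    map_one, rename_pairOp, h, finRotate_last, Fin.castSucc_lt_castSucc_iff, Fin.castSucc_lt_last,
    if_true, lt_irrefl, if_false, Fin.not_lt.2 (Fin.le_last _), Finset.prod_const_one, mul_one,
    Finset.prod_mul_distrib]

/-- Moving the last argument to the front reverses its n factors, which costs the shift E_0^(n + 1),
and the n-cycle of transpositions gives the sign (-1)^n. -/
theorem alphaValue_snoc {n : ℕ} (t : Fin n → ℤ) (y : ℤ) :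
    alphaValue (Fin.snoc (α := fun _ => ℤ) t y : Fin (n + 1) → ℤ) =
      (-1) ^ n * alphaValue (Fin.cons (y + (n + 1)) t : Fin (n + 1) → ℤ) := by
  have h1 : (Fin.snoc (α := fun _ => ℤ) t y : Fin (n + 1) → ℤ) =
      (Fin.cons y t : Fin (n + 1) → ℤ) ∘ finRotate (n + 1) := by
    ext i
    induction i using Fin.lastCases with
    | last => simp
    | cast i => simp
  have h2 : (fun k : Fin (n + 1) → ℤ => binomialDet 0 (n + 1) (k ∘ finRotate (n + 1))) =
      ((-1 : ℚ) ^ n) • binomialDet 0 (n + 1) := by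
    ext k
    rw [binomialDet_comp_perm, sign_finRotate]
    simp
  have h3 : (Fin.cons y t : Fin (n + 1) → ℤ) + Pi.single 0 ((n + 1 : ℕ) : ℤ) =
      Fin.cons (y + (n + 1)) t := by
    ext i
    induction i using Fin.cases <;> simp
  rw [h1, alphaValue_eq_shiftAction, shiftAction_perm, h2, map_smul, Pi.smul_apply, smul_eq_mul,
    rename_finRotate_pairOpProd, shiftAction_mul, shiftAction_prod_pairOp_zero, ← shiftAction_mul,
    mul_left_comm, ← pairOpProd_succ, shiftAction_mul, shiftAction_X_pow, h3,
    alphaValue_eq_shiftAction]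

/-! ### Translation and reflection of α -/

theorem alphaValue_add_const {n : ℕ} (k : Fin n → ℤ) (c : ℤ) :
    alphaValue (fun i => k i + c) = alphaValue k := by
  have h := shiftAction_rename id (fun (k : Fin n → ℤ) i => k i + c) (fun i k => by
    ext j
    simp [add_right_comm]) (pairOpProd n) (binomialDet 0 n) k
  rw [rename_id_apply] at h
  simp only [binomialDet_zero_add_const] at h
  rw [alphaValue_eq_shiftAction, alphaValue_eq_shiftAction, h]

/-- `P` becomes `Q` up to the shift by `-m` when the coordinates are reversed and negated. -/
def ReflectsTo {n : ℕ} (P Q : MvPolynomial (Fin n) ℚ) (m : Fin n → ℤ) : Prop :=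
  ∀ (g : (Fin n → ℤ) → ℚ) (k : Fin n → ℤ),
    shiftAction (Fin n) P g (fun i => -k i.rev) =
      shiftAction (Fin n) Q (fun k => g fun i => -k i.rev) (k - m)

theorem ReflectsTo.one {n : ℕ} : ReflectsTo (1 : MvPolynomial (Fin n) ℚ) 1 0 := by
  intro g k
  simp

theorem shiftAction_comp_sub {n : ℕ} (Q : MvPolynomial (Fin n) ℚ) (g : (Fin n → ℤ) → ℚ)
    (m k : Fin n → ℤ) :
    shiftAction (Fin n) Q (fun k => g (k - m)) k = shiftAction (Fin n) Q g (k - m) := by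
  have h := shiftAction_rename id (fun (k : Fin n → ℤ) => k - m) (fun i k => by
    simp only [id]
    abel) Q g k
  rw [← h, rename_id_apply]

theorem ReflectsTo.mul {n : ℕ} {P Q P' Q' : MvPolynomial (Fin n) ℚ} {m m' : Fin n → ℤ}
    (h : ReflectsTo P Q m) (h' : ReflectsTo P' Q' m') :
    ReflectsTo (P * P') (Q * Q') (m + m') := by
  intro g k
  rw [shiftAction_mul, h, shiftAction_mul]
  simp only [h' g]
  rw [shiftAction_comp_sub _ _ m', sub_sub]

theorem ReflectsTo.prod {n : ℕ} {α : Type*} (s : Finset α) {P Q : α → MvPolynomial (Fin n) ℚ}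
    {m : α → Fin n → ℤ} (h : ∀ x, ReflectsTo (P x) (Q x) (m x)) :
    ReflectsTo (∏ x ∈ s, P x) (∏ x ∈ s, Q x) (∑ x ∈ s, m x) := by
  classical
  induction s using Finset.induction_on with
  | empty => simpa using ReflectsTo.one
  | insert x s hx ih =>
    rw [Finset.prod_insert hx, Finset.prod_insert hx, Finset.sum_insert hx]
    exact (h x).mul ih

/-- Negation inverts the shifts, and 1 - E_p⁻¹ + E_p⁻¹ E_q⁻¹ = E_p⁻¹ E_q⁻¹ (1 - E_q + E_q E_p). -/
theorem reflectsTo_pairOp {n : ℕ} (p q : Fin n) :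
    ReflectsTo (pairOp p q) (pairOp q.rev p.rev) (Pi.single p.rev 1 + Pi.single q.rev 1) := by
  intro g k
  have h : ∀ (k : Fin n → ℤ) (p : Fin n), (fun i => -k i.rev) + Pi.single p 1 =
      fun i => -(k - Pi.single p.rev 1 : Fin n → ℤ) i.rev := by
    intro k p
    ext i
    simp only [Pi.add_apply, Pi.sub_apply, Pi.single_apply, Fin.rev_inj]
    ring
  have e1 := congrArg g (h k p)
  have e2 := congrArg g (h (k - Pi.single p.rev 1) q)
  rw [← h k p] at e2
  have h1 : k - (Pi.single p.rev 1 + Pi.single q.rev 1) + Pi.single q.rev 1 =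
      k - Pi.single p.rev 1 := by abel
  rw [pairOp, pairOp, map_add, map_sub, map_add, map_sub]
  simp only [LinearMap.add_apply, LinearMap.sub_apply]
  rw [Pi.add_apply, Pi.sub_apply, Pi.add_apply, Pi.sub_apply]
  simp only [shiftAction_one, shiftAction_mul]
  rw [shiftAction_X, shiftAction_X, shiftAction_X, shiftAction_X, shiftAction_X, shiftAction_X, h1,
    sub_add_cancel, e1, e2, ← sub_sub]
  ring

/-- Each index lies in n - 1 pairs, so the accumulated shift is the same in every coordinate and
translation invariance of α can absorb it. -/
theorem reflectsTo_pairOpProd (n : ℕ) :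
    ReflectsTo (pairOpProd n) (pairOpProd n) (fun _ => (n : ℤ) - 1) := by
  have h := ReflectsTo.prod (n := n) Finset.univ (P := fun p => ∏ q, if p < q then pairOp p q else 1)
    fun p => ReflectsTo.prod Finset.univ (Q := fun q => if p < q then pairOp q.rev p.rev else 1)
      (m := fun q => if p < q then Pi.single p.rev 1 + Pi.single q.rev 1 else 0) fun q => by
        split_ifs
        · exact reflectsTo_pairOp p q
        · exact ReflectsTo.one
  have h1 : (∏ p : Fin n, ∏ q : Fin n, if p < q then pairOp q.rev p.rev else 1) =
      pairOpProd n := by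
    rw [pairOpProd, Finset.prod_comm, ← Equiv.prod_comp Fin.revPerm]
    refine Finset.prod_congr rfl fun p _ => ?_
    rw [← Equiv.prod_comp Fin.revPerm]
    refine Finset.prod_congr rfl fun q _ => ?_
    simp [Fin.rev_lt_rev]
  have h2 : (∑ p : Fin n, ∑ q : Fin n, if p < q then
      (Pi.single p.rev 1 + Pi.single q.rev 1 : Fin n → ℤ) else 0) = fun _ => (n : ℤ) - 1 := by
    ext x
    have h3 : ∀ p q : Fin n, (if p < q then
        (Pi.single p.rev 1 + Pi.single q.rev 1 : Fin n → ℤ) else 0) x =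
        (if p = x.rev then if p < q then 1 else 0 else 0) +
        if q = x.rev then if p < q then 1 else 0 else 0 := by
      intro p q
      have hr : ∀ p : Fin n, x = p.rev ↔ p = x.rev :=
        fun p => ⟨fun h => by rw [h, Fin.rev_rev], fun h => by rw [h, Fin.rev_rev]⟩
      simp only [ite_apply, Pi.add_apply, Pi.single_apply, Pi.zero_apply, hr]
      split_ifs <;> simp
    simp only [Finset.sum_apply, h3, Finset.sum_add_distrib]
    rw [Finset.sum_comm]
    simp only [Finset.sum_ite_eq', Finset.mem_univ, if_true]
    rw [← Finset.sum_add_distrib, Finset.sum_congr rfl fun q _ =>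
      show _ = (1 : ℤ) - if q = x.rev then 1 else 0 by
        rcases lt_trichotomy q x.rev with h | h | h
        · simp [h, h.ne, h.not_gt]
        · simp [h]
        · simp [h, h.ne', h.not_gt]]
    simp
  rw [h1, h2] at h
  exact h

theorem alphaValue_neg_rev {n : ℕ} (k : Fin n → ℤ) :
    alphaValue (fun i => -k i.rev) = alphaValue k := by
  rw [alphaValue_eq_shiftAction, reflectsTo_pairOpProd]
  simp only [binomialDet_zero_neg_rev]
  rw [← alphaValue_eq_shiftAction, ← alphaValue_add_const k (-((n : ℤ) - 1))]
  rfl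

/-! ### The symmetry in the first argument and the linear system -/

/-- The symmetry of `α(n + 1; x, 2d, 3d, …, (n + 1)d)` as a function of `x`. -/
theorem alphaValue_cons_multiples_symm (n : ℕ) (d x : ℤ) :
    alphaValue (Fin.cons x fun j : Fin n => ((j : ℕ) + 2 : ℤ) * d : Fin (n + 1) → ℤ) =
      (-1) ^ n * alphaValue (Fin.cons ((n + 1) + (n + 3) * d - x)
        fun j : Fin n => ((j : ℕ) + 2 : ℤ) * d : Fin (n + 1) → ℤ) := by
  set t : Fin n → ℤ := fun j => ((j : ℕ) + 2 : ℤ) * d with ht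
  have h1 : (fun i : Fin (n + 1) => -(Fin.cons x t : Fin (n + 1) → ℤ) i.rev) =
      Fin.snoc (α := fun _ => ℤ) (fun j => -t j.rev) (-x) := by
    ext i
    induction i using Fin.lastCases with
    | last => simp
    | cast i => simp [Fin.rev_castSucc]
  have h2 : (fun i => (Fin.cons (-x + (n + 1)) (fun j => -t j.rev) : Fin (n + 1) → ℤ) i +
      (n + 3) * d) = Fin.cons ((n + 1) + (n + 3) * d - x) t := by
    ext i
    induction i using Fin.cases with
    | zero => simp; ring
    | succ i =>
      have : ((i.rev : ℕ) : ℤ) = n - (i + 1) := by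
        rw [Fin.val_rev, Nat.cast_sub (by omega)]
        simp
      simp only [Fin.cons_succ, ht, this]
      ring
  -- Reflect, rotate -x to the front, then translate by (n + 3)d, which restores the multiples 2d,
  -- …, (n + 1)d.
  rw [← alphaValue_neg_rev, h1, alphaValue_snoc, ← alphaValue_add_const _ ((n + 3) * d), h2]

theorem iterate_fwdDiff_comp_const_sub (g : ℤ → ℚ) (m : ℤ) (i : ℕ) (x : ℤ) :
    (fwdDiff (1 : ℤ))^[i] (fun y => g (m - y)) x =
      (-1) ^ i * (fwdDiff (1 : ℤ))^[i] g (m - x - i) := by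
  induction i generalizing x with
  | zero => simp
  | succ i ih =>
    rw [Function.iterate_succ_apply', Function.iterate_succ_apply', fwdDiff, fwdDiff, ih, ih,
      show m - (x + 1) - (i : ℤ) = m - x - ((i + 1 : ℕ) : ℤ) by push_cast; ring,
      show m - x - ((i + 1 : ℕ) : ℤ) + 1 = m - x - i by push_cast; ring]
    ring

theorem refinedNumber_eq_sum (n : ℕ) (d : ℤ) (hd : 1 ≤ d) (i : ℕ) (hi : i ≤ n) :
    refinedNumber (n + 1) d i =
      ∑ j ∈ Finset.Icc i n,
        ((Ring.choose (((n + 1 : ℕ) : ℤ) * (d + 1) - (i : ℤ) - 2) (j - i) : ℤ) : ℚ) *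
          (-1) ^ (j + (n + 1) + 1) * refinedNumber (n + 1) d j := by
  obtain ⟨L, hL⟩ : ∃ L : ℕ, ((n + 1 : ℕ) : ℤ) * (d + 1) - (i : ℤ) - 2 = L := by
    refine Int.eq_ofNat_of_zero_le ?_
    push_cast
    nlinarith
  have hLn : n - i ≤ L := by
    push_cast at hL
    zify [hi]
    nlinarith
  -- L is the distance from d + 1 to the point where the symmetry places the i-th difference.
  set g : ℤ → ℚ := fun x =>
    alphaValue (Fin.cons x fun j : Fin n => ((j : ℕ) + 2 : ℤ) * d : Fin (n + 1) → ℤ) with hg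
  have hC : ∀ j, refinedNumber (n + 1) d j = (-1) ^ j * (fwdDiff (1 : ℤ))^[j] g (d + 1) := by
    intro j
    simp only [refinedNumber, refinedRow_eq_cons, hg]
  have hsymm : g = ((-1 : ℚ) ^ n) • fun x => g ((n + 1) + (n + 3) * d - x) := by
    ext x
    exact alphaValue_cons_multiples_symm n d x
  have h1 : refinedNumber (n + 1) d i =
      (-1) ^ n * (fwdDiff (1 : ℤ))^[i] g (d + 1 + L • (1 : ℤ)) := by
    rw [hC]
    conv_lhs => rw [hsymm]
    rw [fwdDiff_iter_const_smul, Pi.smul_apply, smul_eq_mul, iterate_fwdDiff_comp_const_sub,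
      show ((n : ℤ) + 1) + (n + 3) * d - (d + 1) - i = d + 1 + L • (1 : ℤ) by
        rw [nsmul_eq_mul, ← hL]; push_cast; ring]
    rw [mul_left_comm, ← mul_assoc ((-1 : ℚ) ^ i), ← mul_pow]
    simp
  have hsign : ∀ j, ((-1 : ℚ) ^ (j + (n + 1) + 1)) * (-1) ^ j = (-1) ^ n := by
    intro j
    rw [← pow_add, show j + (n + 1) + 1 + j = n + 2 * (j + 1) by ring, pow_add, pow_mul]
    simp
  -- Newton's formula runs over s ≤ L. As n - i ≤ L, it can be cut at s = n - i, the later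
  -- differences having order above n and hence vanishing.
  rw [h1, shift_eq_sum_fwdDiff_iter 1 ((fwdDiff (1 : ℤ))^[i] g), Finset.mul_sum, hL,
    ← Finset.sum_subset (Finset.range_mono (Nat.succ_le_succ hLn))]
  · refine Finset.sum_nbij' (fun s => i + s) (fun j => j - i) ?_ ?_ ?_ ?_ ?_
    · intro s hs
      simp only [Finset.mem_range, Finset.mem_Icc] at hs ⊢
      omega
    · intro j hj
      simp only [Finset.mem_range, Finset.mem_Icc] at hj ⊢
      omega
    · intro s _
      omega
    · intro j hj
      simp only [Finset.mem_Icc] at hj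
      omega
    · intro s _
      rw [hC, Nat.add_sub_cancel_left, Ring.choose_natCast, ← Function.iterate_add_apply,
        add_comm s i, mul_assoc, ← mul_assoc ((-1 : ℚ) ^ (i + s + (n + 1) + 1)), hsign, nsmul_eq_mul]
      push_cast
      ring
  · intro s _ hs
    have h2 := refinedNumber_eq_zero n d hd (s + i) (by simp at hs; omega)
    rw [hC, mul_eq_zero] at h2
    rw [← Function.iterate_add_apply, h2.resolve_left (by simp), smul_zero, mul_zero]

theorem proposition3p1 (n : ℕ) (d : ℤ) (hn : 1 ≤ n) (hd : 1 ≤ d) :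
    -- `α(n; k)` counts the monotone triangles with bottom row `k`
    (∀ k : Fin n → ℤ, StrictMono k → alphaValue k = ((monotoneTriangles k).ncard : ℚ)) ∧
    -- the combinatorial meaning of the numbers `C^{(d)}_{n,i}`
    (∀ i : ℕ, refinedNumber n d i =
      (({a ∈ monotoneTriangles (fun j : Fin n => ((j : ℕ) + 1 : ℤ) * d) |
          leftDiagonalCount d a = i + 1}).ncard : ℚ)) ∧
    -- the linear equation system
    (∀ i : ℕ, i ≤ n - 1 →
      refinedNumber n d i =
        ∑ j ∈ Finset.Icc i (n - 1),
          ((Ring.choose ((n : ℤ) * (d + 1) - (i : ℤ) - 2) (j - i) : ℤ) : ℚ) *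
            (-1) ^ (j + n + 1) * refinedNumber n d j) := by
  obtain ⟨n, rfl⟩ : ∃ m, n = m + 1 := ⟨n - 1, by omega⟩
  refine ⟨fun k hk => ?_, fun i => ?_, fun i hi => refinedNumber_eq_sum n d hd i hi⟩
  · rw [alphaValue_eq_card k hk, ← Set.ncard_coe_finset]
    congr 2
    ext a
    exact mem_triangleFinset hk
  · rw [refinedNumber_eq_card n d hd, ← Set.ncard_coe_finset]
    congr 2
    ext a
    have hs : StrictMono fun j : Fin (n + 1) => ((j : ℕ) + 1 : ℤ) * d := by
      intro a b hab
      have : ((a : ℕ) : ℤ) < (b : ℕ) := by exact_mod_cast hab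
      simp only
      nlinarith
    simp [mem_triangleFinset hs]
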